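/- Let $M$ be a smooth manifold of dimension $2n+1$ with a contact metric structure $(\varphi,\xi,\eta,g)$: $\eta$ is a contact form with Reeb vector field $\xi$, and the Riemannian metric $g$ and the $(1,1)$-tensor field $\varphi$ satisfy $\varphi^2=-I+\eta\otimes\xi$, $d\eta(X,Y)=g(X,\varphi Y)$, $g(\varphi X,\varphi Y)=g(X,Y)-\eta(X)\eta(Y)$, where $2\,d\eta(X,Y)=X(\eta(Y))-Y(\eta(X))-\eta([X,Y])$. Put $h=\frac12\mathcal L_\xi\varphi$. Let $\kappa,\mu\in\mathbb R$ and suppose that $M$ is a contact metric $(\kappa,\mu)$-manifold, i.e. the curvature tensor $R_{XY}=[\nabla_X,\nabla_Y]-\nabla_{[X,Y]}$ of the Levi-Civita connection satisfies $$R_{XY}\xi=\kappa\big(\eta(Y)X-\eta(X)Y\big)+\mu\big(\eta(Y)hX-\eta(X)hY\big)$$ for all vector fields $X,Y$, and that it is not Sasakian, i.e. the tensor field $N_\varphi(X,Y)=\varphi^2[X,Y]+[\varphi X,\varphi Y]-\varphi[\varphi X,Y]-\varphi[X,\varphi Y]+2d\eta(X,Y)\xi$ does not vanish identically. Then $\kappa<1$,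 so that $\lambda:=\sqrt{1-\kappa}>0$ and $I_M:=\frac{1-\mu/2}{\sqrt{1-\kappa}}$ are defined, and the eigenspaces $\mathcal D(\lambda)$ and $\mathcal D(-\lambda)$ of $h$ form a bi-Legendrian structure, i.e. they are transversal involutive smooth subbundles of rank $n$ of $\ker\eta$ on which $d\eta$ vanishes. For such a subbundle $L$ let $\Pi_L(X,X')=2\,d\eta([\xi,X],X')$ for sections $X,X'$ of $L$. Call $L$ positive definite, negative definite or flat if the bilinear form $\Pi_L$ is positive definite at every point, is negative definite at every point, or vanishes identically, respectively, and call the bi-Legendrian structure flat if both of its members are flat. Then the bi-Legendrian structure $(\mathcal D(\lambda),\mathcal D(-\lambda))$ is not flat. More precisely, exactly one of the following cases occurs: (I) both $\mathcal D(\lambda)$ and $\mathcal D(-\lambda)$ are positive definite; (II) $\mathcal D(\lambda)$ is positive definite and $\mathcal D(-\lambda)$ is negative definite; (III) both $\mathcal D(\lambda)$ and $\mathcal D(-\lambda)$ are negative definite; (IV) $\mathcal D(\lambda)$ is positive definite and $\mathcal D(-\lambda)$ is flat; (V) $\mathcal D(\lambda)$ is flat and $\mathcal D(-\lambda)$ is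 negative definite. Furthermore, $M$ belongs to the class (I), (II), (III), (IV), (V) if and only if $I_M>1$, $-1<I_M<1$, $I_M<-1$, $I_M=1$, $I_M=-1$, respectively. -/

import Mathlib

open Bundle Manifold VectorField
open scoped ContDiff

noncomputable section

namespace ContactKM

/-- The model space `ℝ^(2n+1)`. -/
abbrev Model (n : ℕ) : Type := EuclideanSpace ℝ (Fin (2 * n + 1))

section Basic

variable {n : ℕ} {M : Type*} [TopologicalSpace M] [ChartedSpace (Model n) M]
  [IsManifold (𝓡 (2 * n + 1)) ∞ M]

variable (n M) in
/-- The tangent space at a point of the `(2n+1)`-dimensional manifold `M`. -/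
abbrev Tan (x : M) : Type := TangentSpace (𝓡 (2 * n + 1)) x

variable (n M) in
/-- (Not necessarily smooth) vector fields. -/
abbrev VField : Type _ := (x : M) → Tan n M x

/-- The vector field `X` is smooth near `x`. -/
def SmoothAt (X : VField n M) (x : M) : Prop :=
  ContMDiffAt (𝓡 (2 * n + 1)) ((𝓡 (2 * n + 1)).prod 𝓘(ℝ, Model n)) ∞
    (fun y => TotalSpace.mk' (Model n) y (X y)) x

/-- The vector field `X` is differentiable at `x`. -/
def DiffAt (X : VField n M) (x : M) : Prop :=
  MDifferentiableAt (𝓡 (2 * n + 1)) ((𝓡 (2 * n + 1)).prod 𝓘(ℝ, Model n))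
    (fun y => TotalSpace.mk' (Model n) y (X y)) x

/-- The Lie bracket `[X, Y]`. -/
abbrev bracket (X Y : VField n M) : VField n M := mlieBracket (𝓡 (2 * n + 1)) X Y

/-- The differential of a function, `dirD f x v = v(f)` for a tangent vector `v` at `x`. -/
abbrev dirD (f : M → ℝ) (x : M) : Tan n M x →L[ℝ] ℝ := mvfderiv (𝓡 (2 * n + 1)) f x

variable (n M) in
/-- Smooth `1`-forms. -/
structure OneForm where
  /-- The values of the form. -/
  val : (x : M) → Tan n M x →L[ℝ] ℝ
  smooth : ContMDiff (𝓡 (2 * n + 1)) ((𝓡 (2 * n + 1)).prod 𝓘(ℝ, Model n →L[ℝ] ℝ)) ∞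
    (fun x => TotalSpace.mk' (Model n →L[ℝ] ℝ)
      (E := fun x : M => Tan n M x →L[ℝ] Bundle.Trivial M ℝ x) x (val x))

variable (n M) in
/-- Smooth `(1,1)`-tensor fields. -/
structure EndField where
  /-- The values of the tensor field. -/
  val : (x : M) → Tan n M x →L[ℝ] Tan n M x
  smooth : ContMDiff (𝓡 (2 * n + 1)) ((𝓡 (2 * n + 1)).prod 𝓘(ℝ, Model n →L[ℝ] Model n)) ∞
    (fun x => TotalSpace.mk' (Model n →L[ℝ] Model n)
      (E := fun x : M => Tan n M x →L[ℝ] Tan n M x) x (val x))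

variable (n M) in
/-- Smooth vector fields. -/
structure SmoothVField where
  /-- The values of the vector field. -/
  val : VField n M
  smooth : ∀ x, SmoothAt val x

variable (n M) in
/-- Smooth Riemannian metrics. -/
abbrev Metric : Type _ :=
  ContMDiffRiemannianMetric (𝓡 (2 * n + 1)) ∞ (Model n) (fun x : M => Tan n M x)

/-- `φ X` for a `(1,1)`-tensor field `φ` and a vector field `X`. -/
def EndField.app (φ : EndField n M) (X : VField n M) : VField n M := fun x => φ.val x (X x)

theorem EndField.diffAt_app (φ : EndField n M) {X : VField n M} {x : M} (hX : DiffAt X x) :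
    DiffAt (φ.app X) x :=
  MDifferentiableAt.clm_bundle_apply (F₁ := Model n) (F₂ := Model n)
    (E₁ := fun x : M => Tan n M x) (E₂ := fun x : M => Tan n M x)
    ((φ.smooth x).mdifferentiableAt (by simp)) hX

theorem EndField.smoothAt_app (φ : EndField n M) {X : VField n M} {x : M} (hX : SmoothAt X x) :
    SmoothAt (φ.app X) x :=
  ContMDiffAt.clm_bundle_apply (F₁ := Model n) (F₂ := Model n)
    (E₁ := fun x : M => Tan n M x) (E₂ := fun x : M => Tan n M x) (φ.smooth x) hX

theorem OneForm.mdifferentiableAt_app (η : OneForm n M) {X : VField n M} {x : M}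
    (hX : DiffAt X x) :
    MDifferentiableAt (𝓡 (2 * n + 1)) 𝓘(ℝ, ℝ) (fun y => η.val y (X y)) x := by
  have h := MDifferentiableAt.clm_bundle_apply (F₁ := Model n) (F₂ := ℝ)
    (E₁ := fun x : M => Tan n M x) (E₂ := Bundle.Trivial M ℝ)
    ((η.smooth x).mdifferentiableAt (by simp)) hX
  simp only [mdifferentiableAt_totalSpace] at h
  exact h.2

/-- `½ (X(η Y) - Y(η X) - η [X, Y])` for vector fields `X`, `Y`. -/
def OneForm.dAux (η : OneForm n M) (x : M) (X Y : VField n M) : ℝ :=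
  (1 / 2 : ℝ) * (dirD (fun y => η.val y (Y y)) x (X x) - dirD (fun y => η.val y (X y)) x (Y x)
    - η.val x (bracket X Y x))

theorem OneForm.dAux_swap (η : OneForm n M) (x : M) (X Y : VField n M) :
    η.dAux x X Y = - η.dAux x Y X := by
  unfold OneForm.dAux bracket
  rw [mlieBracket_swap_apply (V := X)]
  simp only [map_neg]
  ring

theorem OneForm.dAux_tensorial_right (η : OneForm n M) (x : M) (X : VField n M)
    (_hX : DiffAt X x) :
    TensorialAt (𝓡 (2 * n + 1)) (Model n) (fun Y : VField n M => η.dAux x X Y) x where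
  smul {f Y} hf hY := by
    have h1 := η.mdifferentiableAt_app hY
    have e1 : (fun y => η.val y ((f • Y) y)) = f * fun y => η.val y (Y y) := by
      funext y; simp
    simp only [OneForm.dAux, dirD, bracket, e1]
    rw [mvfderiv_mul hf h1, mlieBracket_smul_right hf hY]
    simp
    ring
  add {Y Z} hY hZ := by
    have h1 := η.mdifferentiableAt_app hY
    have h2 := η.mdifferentiableAt_app hZ
    have e1 : (fun y => η.val y ((Y + Z) y))
        = (fun y => η.val y (Y y)) + fun y => η.val y (Z y) := by
      funext y; simp
    simp only [OneForm.dAux, dirD, bracket, e1]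
    rw [mvfderiv_add h1 h2, mlieBracket_add_right hY hZ]
    simp
    ring

theorem OneForm.dAux_tensorial_left (η : OneForm n M) (x : M) (Y : VField n M)
    (hY : DiffAt Y x) :
    TensorialAt (𝓡 (2 * n + 1)) (Model n) (fun X : VField n M => η.dAux x X Y) x where
  smul {f X} hf hX := by
    rw [η.dAux_swap x, (η.dAux_tensorial_right x Y hY).smul hf hX, η.dAux_swap x X]
    simp
  add {X Z} hX hZ := by
    rw [η.dAux_swap x, (η.dAux_tensorial_right x Y hY).add hX hZ, η.dAux_swap x X,
      η.dAux_swap x Z]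
    ring

/-- The exterior derivative of a `1`-form, with the normalisation
`2 dη(X, Y) = X(η Y) - Y(η X) - η [X, Y]` (see `OneForm.d_apply`). -/
def OneForm.d (η : OneForm n M) (x : M) : Tan n M x →L[ℝ] Tan n M x →L[ℝ] ℝ :=
  TensorialAt.mkHom₂ (I := 𝓡 (2 * n + 1)) (F := Model n) (F' := Model n)
    (V := fun x : M => Tan n M x) (V' := fun x : M => Tan n M x) (η.dAux x) x
    (fun Y hY => η.dAux_tensorial_left x Y hY) (fun X hX => η.dAux_tensorial_right x X hX)

theorem OneForm.d_apply (η : OneForm n M) {x : M} {X Y : VField n M}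
    (hX : DiffAt X x) (hY : DiffAt Y x) :
    η.d x (X x) (Y x) = (1 / 2 : ℝ) * (dirD (fun y => η.val y (Y y)) x (X x)
      - dirD (fun y => η.val y (X y)) x (Y x) - η.val x (bracket X Y x)) :=
  TensorialAt.mkHom₂_apply _ _ hX hY

/-- `½ (L_ξ φ) X = ½ ([ξ, φ X] - φ [ξ, X])` for a vector field `X`. -/
def halfLieAux (ξ : SmoothVField n M) (φ : EndField n M) (x : M) (X : VField n M) : Tan n M x :=
  (1 / 2 : ℝ) • (bracket ξ.val (φ.app X) x - φ.val x (bracket ξ.val X x))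

theorem halfLieAux_tensorial (ξ : SmoothVField n M) (φ : EndField n M) (x : M) :
    TensorialAt (𝓡 (2 * n + 1)) (Model n) (fun X : VField n M => halfLieAux ξ φ x X) x where
  smul {f X} hf hX := by
    have h1 : DiffAt (φ.app X) x := φ.diffAt_app hX
    have e1 : φ.app (f • X) = f • φ.app X := by
      funext y; simp [EndField.app]
    simp only [halfLieAux, bracket, e1]
    rw [mlieBracket_smul_right hf h1, mlieBracket_smul_right hf hX]
    simp only [EndField.app, map_add, map_smul]
    module
  add {X Y} hX hY := by
    have h1 : DiffAt (φ.app X) x := φ.diffAt_app hX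
    have h2 : DiffAt (φ.app Y) x := φ.diffAt_app hY
    have e1 : φ.app (X + Y) = φ.app X + φ.app Y := by
      funext y; simp [EndField.app]
    simp only [halfLieAux, bracket, e1]
    rw [mlieBracket_add_right h1 h2, mlieBracket_add_right hX hY]
    simp only [map_add]
    module

/-- The `(1,1)`-tensor `½ L_ξ φ` (see `halfLie_apply`). -/
def halfLie (ξ : SmoothVField n M) (φ : EndField n M) (x : M) : Tan n M x →L[ℝ] Tan n M x :=
  TensorialAt.mkHom (I := 𝓡 (2 * n + 1)) (F := Model n) (V := fun x : M => Tan n M x)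
    (halfLieAux ξ φ x) x (halfLieAux_tensorial ξ φ x)

theorem halfLie_apply (ξ : SmoothVField n M) (φ : EndField n M) {x : M} {X : VField n M}
    (hX : DiffAt X x) :
    halfLie ξ φ x (X x)
      = (1 / 2 : ℝ) • (bracket ξ.val (φ.app X) x - φ.val x (bracket ξ.val X x)) :=
  TensorialAt.mkHom_apply _ hX

variable (n M) in
/-- Affine connections on `M`; for a connection `D`, the vector `(∇_v Y)(x)` is `D Y x v`. -/
abbrev Connection : Type _ :=
  CovariantDerivative (𝓡 (2 * n + 1)) (Model n) (fun x : M => Tan n M x)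

/-- `D` is the Levi-Civita connection of `g`: it is torsion free and `∇g = 0`. -/
structure IsLeviCivita (g : Metric n M) (D : Connection n M) : Prop where
  torsion_free : D.torsion = 0
  metric : ∀ (x : M) (v : Tan n M x) (Y Z : VField n M), DiffAt Y x → DiffAt Z x →
    dirD (fun y => g.inner y (Y y) (Z y)) x v
      = g.inner x (D Y x v) (Z x) + g.inner x (Y x) (D Z x v)

/-- The curvature `R_{XY} Z = ∇_X ∇_Y Z - ∇_Y ∇_X Z - ∇_{[X,Y]} Z`. -/
def curvature (D : Connection n M) (X Y Z : VField n M) (x : M) : Tan n M x :=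
  D (fun y => D Z y (Y y)) x (X x) - D (fun y => D Z y (X y)) x (Y x) - D Z x (bracket X Y x)

end Basic

/-- A contact metric structure `(φ, ξ, η, g)` on a `(2n+1)`-dimensional smooth manifold: `η` is
a `1`-form with Reeb vector field `ξ`, and `g` and `φ` are compatible with them. The contact
condition `η ∧ (dη)^n ≠ 0` is automatic: by `d_eta` and `phi_sq` the form `dη` is nondegenerate
on `ker η` (see `ContactMetricStructure.d_eta_phi_ne_zero`), and `η` does not vanish. -/
structure ContactMetricStructure (n : ℕ) (M : Type*) [TopologicalSpace M]
    [ChartedSpace (Model n) M] [IsManifold (𝓡 (2 * n + 1)) ∞ M] where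
  /-- The structure tensor. -/
  phi : EndField n M
  /-- The Reeb vector field. -/
  xi : SmoothVField n M
  /-- The contact form. -/
  eta : OneForm n M
  /-- The associated metric. -/
  g : Metric n M
  eta_xi : ∀ x, eta.val x (xi.val x) = 1
  d_eta_xi : ∀ x (v : Tan n M x), eta.d x (xi.val x) v = 0
  phi_sq : ∀ x (v : Tan n M x), phi.val x (phi.val x v) = - v + eta.val x v • xi.val x
  d_eta : ∀ x (v w : Tan n M x), eta.d x v w = g.inner x v (phi.val x w)
  g_phi : ∀ x (v w : Tan n M x),
    g.inner x (phi.val x v) (phi.val x w) = g.inner x v w - eta.val x v * eta.val x w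

variable {n : ℕ} {M : Type*} [TopologicalSpace M] [ChartedSpace (Model n) M]
  [IsManifold (𝓡 (2 * n + 1)) ∞ M]

namespace ContactMetricStructure

theorem d_eta_phi_ne_zero (S : ContactMetricStructure n M) (x : M) (v : Tan n M x)
    (hv : S.eta.val x v = 0) (hv0 : v ≠ 0) : S.eta.d x v (S.phi.val x v) ≠ 0 := by
  rw [S.d_eta, S.phi_sq, hv]
  have h := S.g.pos x v hv0
  simp only [zero_smul, add_zero, map_neg]
  exact (neg_neg_of_pos h).ne

/-- The tensor field `h = ½ L_ξ φ`. -/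
def h (S : ContactMetricStructure n M) (x : M) : Tan n M x →L[ℝ] Tan n M x :=
  halfLie S.xi S.phi x

/-- `N_φ(X, Y) = φ²[X, Y] + [φX, φY] - φ[φX, Y] - φ[X, φY] + 2 dη(X, Y) ξ`. -/
def nijenhuis (S : ContactMetricStructure n M) (X Y : VField n M) (x : M) : Tan n M x :=
  S.phi.val x (S.phi.val x (bracket X Y x)) + bracket (S.phi.app X) (S.phi.app Y) x
    - S.phi.val x (bracket (S.phi.app X) Y x) - S.phi.val x (bracket X (S.phi.app Y) x)
    + (2 * S.eta.d x (X x) (Y x)) • S.xi.val x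

/-- The structure is Sasakian: `N_φ` vanishes identically. -/
def IsSasakian (S : ContactMetricStructure n M) : Prop :=
  ∀ (x : M) (X Y : VField n M), SmoothAt X x → SmoothAt Y x → S.nijenhuis X Y x = 0

/-- The `(κ, μ)`-nullity condition for the curvature tensor of the Levi-Civita connection. -/
def IsKappaMu (S : ContactMetricStructure n M) (κ μ : ℝ) : Prop :=
  ∃ D : Connection n M, IsLeviCivita S.g D ∧
    ∀ (x : M) (X Y : VField n M), SmoothAt X x → SmoothAt Y x →
      curvature D X Y S.xi.val x
        = κ • (S.eta.val x (Y x) • X x - S.eta.val x (X x) • Y x)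
          + μ • (S.eta.val x (Y x) • S.h x (X x) - S.eta.val x (X x) • S.h x (Y x))

/-- The family of eigenspaces `𝒟(c) = ker (h - c)`. -/
def eigenDist (S : ContactMetricStructure n M) (c : ℝ) (x : M) : Submodule ℝ (Tan n M x) :=
  Module.End.eigenspace (S.h x : Tan n M x →ₗ[ℝ] Tan n M x) c

end ContactMetricStructure

/-- `X` is a smooth section near `x` of the family `L` of subspaces of the tangent spaces. -/
def IsSectionAt (L : (x : M) → Submodule ℝ (Tan n M x)) (X : VField n M) (x : M) : Prop :=
  SmoothAt X x ∧ ∀ᶠ y in nhds x, X y ∈ L y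

namespace ContactMetricStructure

/-- `L` is the tangent bundle of a Legendre foliation of `(M, η)`: a smooth subbundle of rank `n`
of `ker η` on which `dη` vanishes and which is involutive. Smoothness of the subbundle is
expressed by local smooth sections through every vector of `L`. -/
structure IsLegendreFoliation (S : ContactMetricStructure n M)
    (L : (x : M) → Submodule ℝ (Tan n M x)) : Prop where
  rank : ∀ x, Module.finrank ℝ (L x) = n
  smooth : ∀ x, ∀ v ∈ L x, ∃ X : VField n M, IsSectionAt L X x ∧ X x = v
  le_ker : ∀ x, ∀ v ∈ L x, S.eta.val x v = 0
  isotropic : ∀ x, ∀ v ∈ L x, ∀ w ∈ L x, S.eta.d x v w = 0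
  involutive : ∀ (x : M) (X Y : VField n M), IsSectionAt L X x → IsSectionAt L Y x →
    bracket X Y x ∈ L x

/-- `(L₁, L₂)` is a bi-Legendrian structure: a pair of transversal Legendre foliations. -/
structure IsBiLegendrian (S : ContactMetricStructure n M)
    (L₁ L₂ : (x : M) → Submodule ℝ (Tan n M x)) : Prop where
  left : S.IsLegendreFoliation L₁
  right : S.IsLegendreFoliation L₂
  transversal : ∀ x, L₁ x ⊓ L₂ x = ⊥

/-- Pang's invariant `Π(X, Y) = 2 dη([ξ, X], Y)`, to be evaluated on sections `X`, `Y` of a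
Legendre foliation. -/
def pang (S : ContactMetricStructure n M) (X Y : VField n M) (x : M) : ℝ :=
  2 * S.eta.d x (bracket S.xi.val X x) (Y x)

/-- Pang's invariant of `L` is positive definite. -/
def PositiveDefinite (S : ContactMetricStructure n M)
    (L : (x : M) → Submodule ℝ (Tan n M x)) : Prop :=
  ∀ (x : M) (X : VField n M), IsSectionAt L X x → X x ≠ 0 → 0 < S.pang X X x

/-- Pang's invariant of `L` is negative definite. -/
def NegativeDefinite (S : ContactMetricStructure n M)
    (L : (x : M) → Submodule ℝ (Tan n M x)) : Prop :=
  ∀ (x : M) (X : VField n M), IsSectionAt L X x → X x ≠ 0 → S.pang X X x < 0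

/-- `L` is flat: Pang's invariant of `L` vanishes identically. -/
def Flat (S : ContactMetricStructure n M)
    (L : (x : M) → Submodule ℝ (Tan n M x)) : Prop :=
  ∀ (x : M) (X Y : VField n M), IsSectionAt L X x → IsSectionAt L Y x → S.pang X Y x = 0

end ContactMetricStructure

/-- The names of the five classes. -/
inductive PangClass
  | I | II | III | IV | V

/-- The pair `(L₁, L₂)` belongs to the given class. -/
def ContactMetricStructure.HasClass (S : ContactMetricStructure n M)
    (L₁ L₂ : (x : M) → Submodule ℝ (Tan n M x)) : PangClass → Prop
  | .I => S.PositiveDefinite L₁ ∧ S.PositiveDefinite L₂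
  | .II => S.PositiveDefinite L₁ ∧ S.NegativeDefinite L₂
  | .III => S.NegativeDefinite L₁ ∧ S.NegativeDefinite L₂
  | .IV => S.PositiveDefinite L₁ ∧ S.Flat L₂
  | .V => S.Flat L₁ ∧ S.NegativeDefinite L₂

/-- The Boeckx invariant `(1 - μ/2) / √(1 - κ)`. -/
def boeckx (κ μ : ℝ) : ℝ := (1 - μ / 2) / √(1 - κ)

end ContactKM

end

/-! Since `∇_ξ φ = 0` (`nablaPhi_xi`), the tensor `h` is governed by `∇ξ = -φ - φh` (`nabla_xi`): it
is symmetric, anticommutes with `φ` and kills `ξ`. Substituting this into `R_{ξX}ξ` turns the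
nullity condition into a formula for `φ(∇_ξ h)` (`phi_nabla_h_xi`). Comparing that formula at `X`
and at `φX` gives `h² = (κ-1)φ²` (`h_sq`), hence `|hv|² = (1-κ)|φv|²`. If `κ > 1` then `φ = 0`; if
`κ = 1` then `h = 0` and the nullity condition determines `∇φ`. Both cases force `N_φ = 0`, so `κ <
1`.

Then `h² = λ²` on `ker η`, which splits into `𝒟(λ) ⊕ 𝒟(-λ)`; `φ` exchanges the summands, so each has
rank `n`. Involutivity comes from a stronger fact: `∇_X Y` stays in `𝒟(c)` for `X`, `Y` in `𝒟(c)`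
(`IsEigenfield.conn_mem`), proved by playing the nullity condition against the closedness of `dη`
(`IsEigenfield.ip_conn_phi_eq_zero`).

The formula for `φ(∇_ξ h)` also fixes the component of `∇_ξ X` in `𝒟(-c)`, so that `Π = 2(1 + c -
μ/2) g` on `𝒟(c)` for `c = ±λ` (`pang_eigenfield`). The classification is the table of signs of `1 ±
λ - μ/2`. -/

noncomputable section

namespace ContactKM

/-! ### Calculus of smooth functions and vector fields. -/

section Calculus

variable {n : ℕ} {M : Type*} [TopologicalSpace M] [ChartedSpace (Model n) M]
  [IsManifold (𝓡 (2 * n + 1)) ∞ M]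

/-- The real function `f` is smooth near `x`. -/
abbrev SmoothFunAt (f : M → ℝ) (x : M) : Prop :=
  ContMDiffAt (𝓡 (2 * n + 1)) 𝓘(ℝ, ℝ) ∞ f x

/-- The real function `f` is differentiable at `x`. -/
abbrev DiffFunAt (f : M → ℝ) (x : M) : Prop :=
  MDifferentiableAt (𝓡 (2 * n + 1)) 𝓘(ℝ, ℝ) f x

omit [IsManifold (𝓡 (2 * n + 1)) ∞ M] in
theorem SmoothFunAt.diffFunAt {f : M → ℝ} {x : M} (hf : SmoothFunAt (n := n) f x) :
    DiffFunAt (n := n) f x :=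
  ContMDiffAt.mdifferentiableAt hf (by simp)

theorem SmoothAt.diffAt {X : VField n M} {x : M} (hX : SmoothAt X x) : DiffAt X x :=
  ContMDiffAt.mdifferentiableAt hX (by simp)

theorem SmoothAt.eventually_diffAt {X : VField n M} {x : M} (hX : SmoothAt X x) :
    ∀ᶠ y in nhds x, DiffAt X y := by
  have h1 := (contMDiffAt_iff_contMDiffAt_nhds (n := 1) (by simp)).1
    (ContMDiffAt.of_le hX (by simp))
  filter_upwards [h1] with y hy
  exact ContMDiffAt.mdifferentiableAt hy (by simp)

theorem SmoothAt.congr {X Y : VField n M} {x : M} (hX : SmoothAt X x)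
    (h : ∀ᶠ y in nhds x, Y y = X y) : SmoothAt Y x := by
  refine ContMDiffAt.congr_of_eventuallyEq hX ?_
  filter_upwards [h] with y hy
  rw [hy]

theorem SmoothAt.add {X Y : VField n M} {x : M} (hX : SmoothAt X x) (hY : SmoothAt Y x) :
    SmoothAt (X + Y) x :=
  ContMDiffAt.add_section hX hY

theorem SmoothAt.neg {X : VField n M} {x : M} (hX : SmoothAt X x) : SmoothAt (-X) x :=
  ContMDiffAt.neg_section hX

theorem SmoothAt.sub {X Y : VField n M} {x : M} (hX : SmoothAt X x) (hY : SmoothAt Y x) :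
    SmoothAt (X - Y) x :=
  ContMDiffAt.sub_section hX hY

theorem SmoothAt.smul {f : M → ℝ} {X : VField n M} {x : M} (hf : SmoothFunAt (n := n) f x)
    (hX : SmoothAt X x) : SmoothAt (f • X) x :=
  ContMDiffAt.smul_section hf hX

theorem SmoothAt.const_smul (c : ℝ) {X : VField n M} {x : M}
    (hX : SmoothAt X x) : SmoothAt (c • X) x :=
  ContMDiffAt.const_smul_section hX

theorem SmoothAt.bracket {X Y : VField n M} {x : M} (hX : SmoothAt X x) (hY : SmoothAt Y x) :
    SmoothAt (bracket X Y) x := by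
  have : IsManifold (𝓡 (2 * n + 1)) ((⊤ : ℕ∞) + 1 : WithTop ℕ∞) M := by
    simpa using! (inferInstance : IsManifold (𝓡 (2 * n + 1)) ∞ M)
  have : IsManifold (𝓡 (2 * n + 1)) (minSmoothness ℝ 2) M := by
    simp only [minSmoothness_of_isRCLikeNormedField]
    exact IsManifold.of_le (n := ∞) (ENat.LEInfty.out)
  exact ContMDiffAt.mlieBracket_vectorField (m := ⊤) (n := ⊤) hX hY (by simp)

theorem exists_smoothAt_eq (x : M) (v : Tan n M x) :
    ∃ X : VField n M, SmoothAt X x ∧ X x = v :=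
  ⟨FiberBundle.extend (Model n) v,
    FiberBundle.contMDiffAt_extend (k := ∞) (F := Model n) (V := fun x : M => Tan n M x) _ v,
    by simp⟩

theorem OneForm.smoothFunAt_app (η : OneForm n M) {X : VField n M} {x : M}
    (hX : SmoothAt X x) : SmoothFunAt (n := n) (fun y => η.val y (X y)) x := by
  have h := ContMDiffAt.clm_bundle_apply (F₁ := Model n) (F₂ := ℝ)
    (E₁ := fun x : M => Tan n M x) (E₂ := Bundle.Trivial M ℝ) (η.smooth x) hX
  simp only [contMDiffAt_totalSpace] at h
  exact h.2

/-! Jacobi identity and derivatives along brackets. -/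

theorem bracket_jacobi {X Y Z : VField n M} {x : M} (hX : SmoothAt X x) (hY : SmoothAt Y x)
    (hZ : SmoothAt Z x) :
    bracket X (bracket Y Z) x = bracket (bracket X Y) Z x + bracket Y (bracket X Z) x := by
  have : IsManifold (𝓡 (2 * n + 1)) (minSmoothness ℝ 3) M := by
    simp only [minSmoothness_of_isRCLikeNormedField]
    exact IsManifold.of_le (n := ∞) (ENat.LEInfty.out)
  refine leibniz_identity_mlieBracket_apply ?_ ?_ ?_
  all_goals
    simp only [minSmoothness_of_isRCLikeNormedField]
    first
    | exact ContMDiffAt.of_le hX ENat.LEInfty.out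
    | exact ContMDiffAt.of_le hY ENat.LEInfty.out
    | exact ContMDiffAt.of_le hZ ENat.LEInfty.out

omit [IsManifold (𝓡 (2 * n + 1)) ∞ M] in
theorem bracket_swap (X Y : VField n M) (x : M) : bracket X Y x = - bracket Y X x :=
  mlieBracket_swap_apply

omit [IsManifold (𝓡 (2 * n + 1)) ∞ M] in
theorem bracket_congr_right {X Y Z : VField n M} {x : M} (h : ∀ᶠ y in nhds x, Y y = Z y) :
    bracket X Y x = bracket X Z x :=
  Filter.EventuallyEq.mlieBracket_vectorField_eq (Filter.EventuallyEq.refl _ X) h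

omit [IsManifold (𝓡 (2 * n + 1)) ∞ M] in
theorem dirD_congr {f g : M → ℝ} {x : M} (h : ∀ᶠ y in nhds x, f y = g y) :
    dirD (n := n) f x = dirD g x := by
  have h' : f =ᶠ[nhds x] g := h
  ext v
  simp only [dirD, mvfderiv, h'.mfderiv_eq]
  rfl

theorem bracket_smul_right {f : M → ℝ} {X Y : VField n M} {x : M}
    (hf : DiffFunAt (n := n) f x) (hY : DiffAt Y x) :
    bracket X (f • Y) x = dirD f x (X x) • Y x + f x • bracket X Y x :=
  mlieBracket_smul_right hf hY

end Calculus

variable {n : ℕ} {M : Type*} [TopologicalSpace M] [ChartedSpace (Model n) M]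
  [IsManifold (𝓡 (2 * n + 1)) ∞ M]

namespace ContactMetricStructure

/-! ### Derivatives along brackets and closedness of the differential of the contact form -/

/-- Because `η(ξ) = 1`, the derivative can be recovered from brackets: `Y(f) = η([Y, fξ]) - f η([Y,
ξ])`. Smoothness then follows from that of brackets. -/
theorem smoothFunAt_dirD (S : ContactMetricStructure n M) {f : M → ℝ} {Y : VField n M} {x : M}
    (hf : SmoothFunAt (n := n) f x) (hfd : ∀ᶠ y in nhds x, DiffFunAt (n := n) f y)
    (hY : SmoothAt Y x) :
    SmoothFunAt (n := n) (fun y => dirD f y (Y y)) x := by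
  have hξ := S.xi.smooth x
  have h1 := S.eta.smoothFunAt_app (hY.bracket (SmoothAt.smul hf hξ))
  have h2 := S.eta.smoothFunAt_app (hY.bracket hξ)
  refine ContMDiffAt.congr_of_eventuallyEq (ContMDiffAt.sub h1 (ContMDiffAt.mul hf h2)) ?_
  filter_upwards [hfd] with y hy
  simp only [bracket_smul_right hy (S.xi.smooth y).diffAt, map_add, map_smul, S.eta_xi,
    smul_eq_mul, Pi.mul_apply]
  ring

/-- This is the `ξ`-coefficient in the Jacobi identity for `X`, `Y`, `fξ`: once the Jacobi identity
for `X`, `Y`, `ξ` is subtracted, pairing with `η` leaves the commutator of derivatives of `f`. -/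
theorem dirD_bracket (S : ContactMetricStructure n M) {f : M → ℝ} {X Y : VField n M} {x : M}
    (hf : SmoothFunAt (n := n) f x) (hfd : ∀ᶠ y in nhds x, DiffFunAt (n := n) f y)
    (hX : SmoothAt X x) (hY : SmoothAt Y x) :
    dirD f x (bracket X Y x) = dirD (fun y => dirD f y (Y y)) x (X x)
      - dirD (fun y => dirD f y (X y)) x (Y x) := by
  have hξ := S.xi.smooth x
  have expand : ∀ {U V : VField n M}, SmoothAt U x → SmoothAt V x →
      bracket U (bracket V (f • S.xi.val)) x
        = dirD (fun y => dirD f y (V y)) x (U x) • S.xi.val x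
          + dirD f x (V x) • bracket U S.xi.val x + dirD f x (U x) • bracket V S.xi.val x
          + f x • bracket U (bracket V S.xi.val) x := by
    intro U V hU hV
    have hc : bracket U (bracket V (f • S.xi.val)) x
        = bracket U ((fun y => dirD f y (V y)) • S.xi.val + f • bracket V S.xi.val) x := by
      apply bracket_congr_right
      filter_upwards [hfd] with y hy
      rw [bracket_smul_right hy (S.xi.smooth y).diffAt]
      rfl
    have h1 := S.smoothFunAt_dirD hf hfd hV
    rw [hc, bracket, mlieBracket_add_right (SmoothAt.smul h1 hξ).diffAt
      (SmoothAt.smul hf (hV.bracket hξ)).diffAt,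
      mlieBracket_smul_right h1.diffFunAt hξ.diffAt,
      mlieBracket_smul_right hf.diffFunAt (hV.bracket hξ).diffAt]
    module
  have J := bracket_jacobi hX hY (SmoothAt.smul hf hξ)
  have J0 := bracket_jacobi hX hY hξ
  rw [expand hX hY, expand hY hX, bracket_smul_right hf.diffFunAt hξ.diffAt, J0] at J
  have J1 := congrArg (S.eta.val x) J
  simp only [map_add, map_smul, S.eta_xi, smul_eq_mul] at J1
  linarith

/-- This is `d(dη) = 0`. The second derivatives of `η(X)`, `η(Y)`, `η(Z)` combine by `dirD_bracket`,
and the double brackets cancel by Jacobi. -/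
theorem d_eta_closed (S : ContactMetricStructure n M) {X Y Z : VField n M} {x : M}
    (hX : SmoothAt X x) (hY : SmoothAt Y x) (hZ : SmoothAt Z x) :
    dirD (fun y => S.eta.d y (Y y) (Z y)) x (X x) + dirD (fun y => S.eta.d y (Z y) (X y)) x (Y x)
      + dirD (fun y => S.eta.d y (X y) (Y y)) x (Z x)
      = S.eta.d x (bracket X Y x) (Z x) + S.eta.d x (bracket Y Z x) (X x)
        + S.eta.d x (bracket Z X x) (Y x) := by
  have appd : ∀ {U : VField n M}, SmoothAt U x →
      ∀ᶠ y in nhds x, DiffFunAt (n := n) (fun y => S.eta.val y (U y)) y := by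
    intro U hU
    filter_upwards [hU.eventually_diffAt] with y hy using S.eta.mdifferentiableAt_app hy
  have key : ∀ {U V W : VField n M}, SmoothAt U x → SmoothAt V x → SmoothAt W x →
      dirD (fun y => S.eta.d y (V y) (W y)) x (U x)
        = (1 / 2 : ℝ) * (dirD (fun y => dirD (fun z => S.eta.val z (W z)) y (V y)) x (U x)
          - dirD (fun y => dirD (fun z => S.eta.val z (V z)) y (W y)) x (U x)
          - dirD (fun y => S.eta.val y (bracket V W y)) x (U x)) := by
    intro U V W hU hV hW
    have hc : dirD (n := n) (fun y => S.eta.d y (V y) (W y)) x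
        = dirD (n := n) ((fun _ => (1 / 2 : ℝ)) *
            ((fun y => dirD (fun z => S.eta.val z (W z)) y (V y))
            - (fun y => dirD (fun z => S.eta.val z (V z)) y (W y))
            - (fun y => S.eta.val y (bracket V W y)))) x := by
      apply dirD_congr
      filter_upwards [hV.eventually_diffAt, hW.eventually_diffAt] with y h1 h2
      rw [S.eta.d_apply h1 h2]
      rfl
    have e1 := (S.smoothFunAt_dirD (S.eta.smoothFunAt_app hW) (appd hW) hV).diffFunAt
    have e2 := (S.smoothFunAt_dirD (S.eta.smoothFunAt_app hV) (appd hV) hW).diffFunAt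
    have e3 := (S.eta.smoothFunAt_app (hV.bracket hW)).diffFunAt
    rw [hc]
    simp only [dirD]
    rw [mvfderiv_mul mdifferentiableAt_const ((e1.sub e2).sub e3), mvfderiv_sub (e1.sub e2) e3,
      mvfderiv_sub e1 e2, mvfderiv_const]
    simp
  rw [key hX hY hZ, key hY hZ hX, key hZ hX hY,
    S.eta.d_apply (hX.bracket hY).diffAt hZ.diffAt,
    S.eta.d_apply (hY.bracket hZ).diffAt hX.diffAt,
    S.eta.d_apply (hZ.bracket hX).diffAt hY.diffAt,
    S.dirD_bracket (S.eta.smoothFunAt_app hZ) (appd hZ) hX hY,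
    S.dirD_bracket (S.eta.smoothFunAt_app hX) (appd hX) hY hZ,
    S.dirD_bracket (S.eta.smoothFunAt_app hY) (appd hY) hZ hX]
  have J := congrArg (S.eta.val x) (bracket_jacobi hX hY hZ)
  -- Bring the Jacobi identity to cyclic form, with every double bracket nested on the left.
  rw [bracket_swap X (bracket Y Z) x, bracket_swap Y (bracket X Z) x,
    show bracket (bracket X Z) Y x = - bracket (bracket Z X) Y x from ?_] at J
  · simp only [map_add, map_neg] at J
    linarith
  · have : bracket X Z = - bracket Z X := mlieBracket_swap
    rw [this]
    have h := mlieBracket_const_smul_left (𝕜 := ℝ) (I := 𝓡 (2 * n + 1)) (c := (-1 : ℝ)) (W := Y)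
      (hZ.bracket hX).diffAt
    simpa using! h

/-! ### Pointwise algebra of the structure tensors -/

/-- The value of the metric on two tangent vectors. -/
def ip (S : ContactMetricStructure n M) (x : M) (v w : Tan n M x) : ℝ := S.g.inner x v w

section ip

variable (S : ContactMetricStructure n M) (x : M) (u v w : Tan n M x) (c : ℝ)

theorem ip_comm : S.ip x v w = S.ip x w v := S.g.symm x v w

theorem ip_add_left : S.ip x (u + v) w = S.ip x u w + S.ip x v w := by simp [ip]

theorem ip_sub_left : S.ip x (u - v) w = S.ip x u w - S.ip x v w := by simp [ip]

theorem ip_neg_left : S.ip x (-v) w = - S.ip x v w := by simp [ip]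

theorem ip_smul_left : S.ip x (c • v) w = c * S.ip x v w := by simp [ip]

theorem ip_zero_left : S.ip x 0 w = 0 := by simp [ip]

theorem ip_add_right : S.ip x w (u + v) = S.ip x w u + S.ip x w v := by simp [ip]

theorem ip_sub_right : S.ip x w (u - v) = S.ip x w u - S.ip x w v := by simp [ip]

theorem ip_neg_right : S.ip x w (-v) = - S.ip x w v := by simp [ip]

theorem ip_smul_right : S.ip x w (c • v) = c * S.ip x w v := by simp [ip]

theorem ip_zero_right : S.ip x w 0 = 0 := by simp [ip]

end ip

theorem ip_self_pos (S : ContactMetricStructure n M) {x : M} {v : Tan n M x} (h : v ≠ 0) :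
    0 < S.ip x v v := S.g.pos x v h

theorem eq_zero_of_ip_self (S : ContactMetricStructure n M) {x : M} {v : Tan n M x}
    (h : S.ip x v v = 0) : v = 0 := by
  by_contra hne
  exact (S.ip_self_pos hne).ne' h

theorem eq_of_ip (S : ContactMetricStructure n M) {x : M} {v w : Tan n M x}
    (h : ∀ u, S.ip x v u = S.ip x w u) : v = w := by
  refine sub_eq_zero.1 (S.eq_zero_of_ip_self ?_)
  rw [ip_sub_left, h, sub_self]

theorem d_eta_swap (S : ContactMetricStructure n M) (x : M) (v w : Tan n M x) :
    S.eta.d x v w = - S.eta.d x w v := by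
  obtain ⟨X, hX, rfl⟩ := exists_smoothAt_eq x v
  obtain ⟨Y, hY, rfl⟩ := exists_smoothAt_eq x w
  rw [S.eta.d_apply hX.diffAt hY.diffAt, S.eta.d_apply hY.diffAt hX.diffAt, bracket_swap X Y,
    map_neg]
  ring

theorem ip_phi (S : ContactMetricStructure n M) (x : M) (v w : Tan n M x) :
    S.ip x (S.phi.val x v) w = - S.ip x v (S.phi.val x w) := by
  rw [ip_comm]
  have := S.d_eta_swap x w v
  rwa [S.d_eta, S.d_eta] at this

theorem phi_xi (S : ContactMetricStructure n M) (x : M) : S.phi.val x (S.xi.val x) = 0 := by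
  apply S.eq_of_ip
  intro u
  rw [ip_phi, ip, ← S.d_eta, S.d_eta_xi, ip_zero_left, neg_zero]

/-- Evaluate `φ³v` as `φ²(φv)` and as `φ(φ²v)`; since `φξ = 0`, the difference is `η(φv) ξ`. -/
theorem eta_phi (S : ContactMetricStructure n M) (x : M) (v : Tan n M x) :
    S.eta.val x (S.phi.val x v) = 0 := by
  have h1 := S.phi_sq x (S.phi.val x v)
  rw [S.phi_sq x v] at h1
  simp only [map_add, map_neg, map_smul, S.phi_xi, smul_zero, add_zero] at h1
  have h2 := congrArg (S.eta.val x) h1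
  simp only [map_add, map_neg, map_smul, S.eta_xi, smul_eq_mul, mul_one] at h2
  linarith

theorem ip_xi (S : ContactMetricStructure n M) (x : M) (v : Tan n M x) :
    S.ip x v (S.xi.val x) = S.eta.val x v := by
  have h := S.g_phi x v (S.xi.val x)
  rw [S.phi_xi, S.eta_xi] at h
  simp only [map_zero] at h
  simp only [ip]
  linarith

theorem xi_ip (S : ContactMetricStructure n M) (x : M) (v : Tan n M x) :
    S.ip x (S.xi.val x) v = S.eta.val x v := by
  rw [ip_comm, ip_xi]

theorem phi_cube (S : ContactMetricStructure n M) (x : M) (v : Tan n M x) :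
    S.phi.val x (S.phi.val x (S.phi.val x v)) = - S.phi.val x v := by
  rw [S.phi_sq x (S.phi.val x v), S.eta_phi, zero_smul, add_zero]

/-- With `φ = 0` also `dη = g(·, φ·) = 0`, so every term of `N_φ` vanishes. This disposes of `κ > 1`
and of dimension one. -/
theorem isSasakian_of_phi_eq_zero (S : ContactMetricStructure n M)
    (h0 : ∀ (x : M) (v : Tan n M x), S.phi.val x v = 0) : S.IsSasakian := by
  intro x X Y _ _
  have e : ∀ W : VField n M, S.phi.app W = 0 := fun W => by
    funext y
    exact h0 _ _
  have e1 := S.d_eta x (X x) (Y x)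
  rw [nijenhuis, e1, e, e, h0, h0, h0, h0]
  simp [bracket]

end ContactMetricStructure

/-! ### Rules for connections -/

section Connection

variable (D : Connection n M) {X Y : VField n M} {x : M}

theorem conn_add (hX : DiffAt X x) (hY : DiffAt Y x) : D (X + Y) x = D X x + D Y x :=
  D.isCovariantDerivativeOnUniv.add hX hY

theorem conn_const_smul (c : ℝ) (hX : DiffAt X x) : D (c • X) x = c • D X x :=
  D.isCovariantDerivativeOnUniv.smul_const c hX

theorem conn_neg (hX : DiffAt X x) : D (-X) x = - D X x := by
  have h := conn_const_smul D (-1) hX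
  simpa using h

theorem conn_smul {f : M → ℝ} (hf : DiffFunAt (n := n) f x) (hX : DiffAt X x) (v : Tan n M x) :
    D (f • X) x v = f x • D X x v + dirD f x v • X x := by
  rw [D.isCovariantDerivativeOnUniv.leibniz hX hf]
  rfl

end Connection

namespace ContactMetricStructure

variable (S : ContactMetricStructure n M) {D : Connection n M} {x : M}

/-! ### The derivatives of `φ` and `ξ`, and the algebraic properties of `h`. -/

section LeviCivita

variable (hD : IsLeviCivita S.g D)

include hD

theorem bracket_eq {X Y : VField n M} (hX : SmoothAt X x) (hY : SmoothAt Y x) :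
    bracket X Y x = D Y x (X x) - D X x (Y x) :=
  (D.torsion_eq_zero_iff.1 hD.torsion_free hX.diffAt hY.diffAt).symm

theorem dirD_ip {Y Z : VField n M} (hY : SmoothAt Y x) (hZ : SmoothAt Z x) (v : Tan n M x) :
    dirD (fun y => S.ip y (Y y) (Z y)) x v
      = S.ip x (D Y x v) (Z x) + S.ip x (Y x) (D Z x v) :=
  hD.metric x v Y Z hY.diffAt hZ.diffAt

theorem dirD_eta {Y : VField n M} (hY : SmoothAt Y x) (v : Tan n M x) :
    dirD (fun y => S.eta.val y (Y y)) x v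
      = S.eta.val x (D Y x v) + S.ip x (Y x) (D S.xi.val x v) := by
  have h := S.dirD_ip hD hY (S.xi.smooth x) v
  simpa only [ip_xi] using h

theorem nablaPhi_skew {Y Z : VField n M} (hY : SmoothAt Y x) (hZ : SmoothAt Z x)
    (v : Tan n M x) :
    S.ip x (D (S.phi.app Y) x v - S.phi.val x (D Y x v)) (Z x)
      = - S.ip x (D (S.phi.app Z) x v - S.phi.val x (D Z x v)) (Y x) := by
  have h1 := S.dirD_ip hD (S.phi.smoothAt_app hY) hZ v
  have h2 := S.dirD_ip hD hY (S.phi.smoothAt_app hZ) v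
  have h3 : (fun y => S.ip y (S.phi.app Y y) (Z y))
      = - fun y => S.ip y (Y y) (S.phi.app Z y) := by
    funext y
    exact S.ip_phi y _ _
  rw [h3] at h1
  simp only [dirD, mvfderiv_neg, neg_apply] at h1 h2
  simp only [ip_sub_left, ip_phi, EndField.app] at *
  rw [S.ip_comm x (Y x)] at h1 h2
  rw [ip_phi] at h1
  linarith

/-- Closedness of `dη = g(·, φ·)`, rewritten with the torsion-free metric connection: the terms that
differentiate the arguments cancel and only `∇φ` survives. -/
theorem nablaPhi_cyclic {X Y Z : VField n M} (hX : SmoothAt X x) (hY : SmoothAt Y x)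
    (hZ : SmoothAt Z x) :
    S.ip x (D (S.phi.app Y) x (X x) - S.phi.val x (D Y x (X x))) (Z x)
      + S.ip x (D (S.phi.app Z) x (Y x) - S.phi.val x (D Z x (Y x))) (X x)
      + S.ip x (D (S.phi.app X) x (Z x) - S.phi.val x (D X x (Z x))) (Y x) = 0 := by
  have h := S.d_eta_closed hX hY hZ
  rw [S.bracket_eq hD hX hY, S.bracket_eq hD hY hZ, S.bracket_eq hD hZ hX] at h
  have e : ∀ y (v w : Tan n M y), S.eta.d y v w = S.ip y v (S.phi.val y w) := S.d_eta
  simp only [e] at h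
  have h1 := S.dirD_ip hD hY (S.phi.smoothAt_app hZ) (X x)
  have h2 := S.dirD_ip hD hZ (S.phi.smoothAt_app hX) (Y x)
  have h3 := S.dirD_ip hD hX (S.phi.smoothAt_app hY) (Z x)
  simp only [EndField.app] at h1 h2 h3 ⊢
  rw [h1, h2, h3] at h
  simp only [ip_sub_left, ip_phi] at *
  rw [S.ip_comm x (Y x), S.ip_comm x (Z x), S.ip_comm x (X x)] at h
  have s1 := S.nablaPhi_skew hD hX hY (Z x)
  have s2 := S.nablaPhi_skew hD hY hZ (X x)
  have s3 := S.nablaPhi_skew hD hZ hX (Y x)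
  simp only [ip_sub_left, ip_phi] at s1 s2 s3
  linarith

theorem eta_nabla_xi (v : Tan n M x) : S.eta.val x (D S.xi.val x v) = 0 := by
  have h := S.dirD_eta hD (S.xi.smooth x) v
  have h1 : (fun y => S.eta.val y (S.xi.val y)) = fun _ => (1 : ℝ) := by
    funext y
    exact S.eta_xi y
  rw [h1, S.ip_comm x, ip_xi] at h
  simp only [dirD, mvfderiv_const, zero_apply] at h
  linarith

/-- As `η = g(ξ, ·)`, the skew part of `∇ξ` is `dη`. -/
theorem nabla_xi_skew_part (v w : Tan n M x) :
    S.ip x (D S.xi.val x v) w - S.ip x (D S.xi.val x w) v = 2 * S.ip x v (S.phi.val x w) := by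
  obtain ⟨X, hX, rfl⟩ := exists_smoothAt_eq x v
  obtain ⟨Y, hY, rfl⟩ := exists_smoothAt_eq x w
  have h : _ = S.ip x _ _ := (S.eta.d_apply hX.diffAt hY.diffAt).symm.trans (S.d_eta x _ _)
  rw [S.dirD_eta hD hX, S.dirD_eta hD hY, S.bracket_eq hD hX hY, map_sub,
    S.ip_comm x (X x), S.ip_comm x (Y x)] at h
  linarith

theorem nabla_xi_xi : D S.xi.val x (S.xi.val x) = 0 := by
  apply S.eq_of_ip
  intro u
  have h := S.nabla_xi_skew_part hD (S.xi.val x) u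
  rw [ip_xi, S.eta_nabla_xi hD, S.ip_comm x (S.xi.val x), ip_xi, S.eta_phi] at h
  rw [ip_zero_left]
  linarith

/-- The derivative `∇_ξ φ` in terms of `∇ξ`. -/
theorem ip_nablaPhi_xi {Y Z : VField n M} (hY : SmoothAt Y x) (hZ : SmoothAt Z x) :
    S.ip x (D (S.phi.app Y) x (S.xi.val x) - S.phi.val x (D Y x (S.xi.val x))) (Z x)
      = S.ip x (S.phi.val x (D S.xi.val x (Z x))) (Y x)
        - S.ip x (S.phi.val x (D S.xi.val x (Y x))) (Z x) := by
  have h := S.nablaPhi_cyclic hD (S.xi.smooth x) hY hZ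
  have hs := S.nablaPhi_skew hD hZ (S.xi.smooth x) (Y x)
  have h0 : S.phi.app S.xi.val = 0 := by
    funext y
    exact S.phi_xi y
  rw [h0] at h hs
  have hz : D 0 x = 0 := by simp
  rw [hs, hz] at h
  simp only [zero_apply, ip_sub_left, ip_zero_left] at h ⊢
  linarith

/-- Differentiate `φ² = -I + η ⊗ ξ` along `ξ`, where `∇_ξ ξ = 0`. In other words, `∇_ξ φ`
anticommutes with `φ`. -/
theorem nablaPhi_xi_anticomm {Y : VField n M} (hY : SmoothAt Y x) :
    D (S.phi.app (S.phi.app Y)) x (S.xi.val x)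
      - S.phi.val x (S.phi.val x (D Y x (S.xi.val x))) = 0 := by
  have h0 : S.phi.app (S.phi.app Y) = -Y + (fun y => S.eta.val y (Y y)) • S.xi.val := by
    funext y
    exact S.phi_sq y _
  have hf := S.eta.smoothFunAt_app hY
  have hξ := S.xi.smooth x
  rw [h0, conn_add D hY.neg.diffAt (SmoothAt.smul hf hξ).diffAt, conn_neg D hY.diffAt,
    S.phi_sq, add_apply, conn_smul D hf.diffFunAt hξ.diffAt,
    S.dirD_eta hD hY, S.nabla_xi_xi hD, ip_zero_right]
  simp

/-- `∇_ξ φ = 0`. -/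
theorem nablaPhi_xi {Y : VField n M} (hY : SmoothAt Y x) :
    D (S.phi.app Y) x (S.xi.val x) = S.phi.val x (D Y x (S.xi.val x)) := by
  -- `ip_nablaPhi_xi` and the skew part of `∇ξ` show that `∇_ξ φ` commutes with `φ`. It also
  -- anticommutes with `φ`, so `(∇_ξ φ)φ = 0`. Applying this to `φY` and using `φ³ = -φ` gives the
  -- claim.
  have key : ∀ {Z : VField n M}, SmoothAt Z x →
      D (S.phi.app (S.phi.app Z)) x (S.xi.val x)
        = S.phi.val x (D (S.phi.app Z) x (S.xi.val x)) := by
    intro Z hZ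
    have hφ := S.phi.smoothAt_app hZ
    have h2 := S.nablaPhi_xi_anticomm hD hZ
    refine S.eq_of_ip fun u => ?_
    obtain ⟨U, hU, rfl⟩ := exists_smoothAt_eq x u
    have h1 := S.ip_nablaPhi_xi hD hφ hU
    have h3 := S.ip_nablaPhi_xi hD hZ (S.phi.smoothAt_app hU)
    have h2' := congrArg (fun v => S.ip x v (U x)) h2
    have b1 := S.nabla_xi_skew_part hD (Z x) (U x)
    have b2 := S.nabla_xi_skew_part hD (S.phi.val x (Z x)) (S.phi.val x (U x))
    simp only [EndField.app, ip_sub_left, ip_phi, ip_zero_left, S.phi_sq, ip_add_right,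
      ip_neg_right, ip_smul_right, ip_xi, xi_ip, S.eta_nabla_xi hD, S.eta_phi, mul_zero, add_zero,
      ip_add_left, ip_neg_left, ip_smul_left] at *
    linarith
  have h0 : S.phi.app (S.phi.app (S.phi.app Y)) = - S.phi.app Y := by
    funext y
    exact S.phi_cube y _
  have hφ := S.phi.smoothAt_app hY
  have h1 := key hφ
  rw [h0, conn_neg D hφ.diffAt, sub_eq_zero.1 (S.nablaPhi_xi_anticomm hD hY), S.phi_sq,
    S.eta_phi] at h1
  simpa using h1

theorem ip_phi_nabla_xi_symm (v w : Tan n M x) :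
    S.ip x (S.phi.val x (D S.xi.val x v)) w = S.ip x (S.phi.val x (D S.xi.val x w)) v := by
  obtain ⟨X, hX, rfl⟩ := exists_smoothAt_eq x v
  obtain ⟨Y, hY, rfl⟩ := exists_smoothAt_eq x w
  have h := S.ip_nablaPhi_xi hD hX hY
  rw [S.nablaPhi_xi hD hX, sub_self, ip_zero_left] at h
  linarith

/-- The symmetry of `φ∇ξ` combined with the known skew part of `∇ξ`. -/
theorem nabla_xi_phi (v : Tan n M x) :
    D S.xi.val x (S.phi.val x v)
      = - S.phi.val x (D S.xi.val x v) - (2 : ℝ) • S.phi.val x (S.phi.val x v) := by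
  refine S.eq_of_ip fun u => ?_
  have h1 := S.nabla_xi_skew_part hD (S.phi.val x v) u
  have h2 := S.ip_phi_nabla_xi_symm hD u v
  simp only [ip_sub_left, ip_neg_left, ip_smul_left, ip_phi] at *
  linarith

/-- In `[ξ, φX] - φ[ξ, X]` the derivatives along `ξ` cancel because `∇_ξ φ = 0`, leaving `φ∇_X ξ -
∇_{φX} ξ`. -/
theorem h_eq (v : Tan n M x) :
    S.h x v = S.phi.val x (D S.xi.val x v) + S.phi.val x (S.phi.val x v) := by
  obtain ⟨X, hX, rfl⟩ := exists_smoothAt_eq x v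
  have hξ := S.xi.smooth x
  rw [h, halfLie_apply _ _ hX.diffAt, S.bracket_eq hD hξ (S.phi.smoothAt_app hX),
    S.bracket_eq hD hξ hX, S.nablaPhi_xi hD hX]
  simp only [EndField.app, map_sub, S.nabla_xi_phi hD]
  module

/-- `∇ξ = - φ - φ h`. -/
theorem nabla_xi (v : Tan n M x) :
    D S.xi.val x v = - S.phi.val x v - S.phi.val x (S.h x v) := by
  rw [S.h_eq hD, map_add, S.phi_cube, S.phi_sq, S.eta_nabla_xi hD]
  simp

theorem h_xi : S.h x (S.xi.val x) = 0 := by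
  rw [S.h_eq hD, S.nabla_xi_xi hD, S.phi_xi]
  simp

theorem eta_h (v : Tan n M x) : S.eta.val x (S.h x v) = 0 := by
  rw [S.h_eq hD, map_add, S.eta_phi, S.eta_phi, add_zero]

theorem h_phi (v : Tan n M x) : S.h x (S.phi.val x v) = - S.phi.val x (S.h x v) := by
  rw [S.h_eq hD, S.h_eq hD, S.nabla_xi_phi hD]
  simp only [map_sub, map_neg, map_smul, map_add, S.phi_cube]
  module

theorem h_symm (v w : Tan n M x) : S.ip x (S.h x v) w = S.ip x v (S.h x w) := by
  have h1 := S.ip_phi_nabla_xi_symm hD v w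
  rw [S.h_eq hD, S.h_eq hD, ip_add_left, ip_add_right, h1, S.ip_comm x _ v, ip_phi, ip_phi]
  ring

end LeviCivita

/-- The vector field `h X`. -/
def hApp (X : VField n M) : VField n M := fun y => S.h y (X y)

theorem smoothAt_hApp {X : VField n M} (hX : SmoothAt X x) : SmoothAt (S.hApp X) x := by
  have hξ := S.xi.smooth x
  refine SmoothAt.congr (SmoothAt.const_smul (1 / 2 : ℝ)
    ((hξ.bracket (S.phi.smoothAt_app hX)).sub (S.phi.smoothAt_app (hξ.bracket hX)))) ?_
  filter_upwards [hX.eventually_diffAt] with y hy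
  exact halfLie_apply _ _ hy

/-! ### The curvature `R_{XY}ξ` in terms of `φ` and `h`. -/

section Curvature

variable (hD : IsLeviCivita S.g D)

include hD

theorem nabla_xi_field (X : VField n M) :
    (fun y => D S.xi.val y (X y)) = -S.phi.app X - S.phi.app (S.hApp X) := by
  funext y
  exact S.nabla_xi hD (X y)

theorem curvature_xi {X Y : VField n M} (hX : SmoothAt X x) (hY : SmoothAt Y x) :
    curvature D X Y S.xi.val x
      = - D (S.phi.app Y) x (X x) - D (S.phi.app (S.hApp Y)) x (X x)
        + D (S.phi.app X) x (Y x) + D (S.phi.app (S.hApp X)) x (Y x)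
        + S.phi.val x (D Y x (X x) - D X x (Y x))
        + S.phi.val x (S.h x (D Y x (X x) - D X x (Y x))) := by
  have hφ : ∀ {Z : VField n M}, SmoothAt Z x →
      D (-S.phi.app Z - S.phi.app (S.hApp Z)) x
        = - D (S.phi.app Z) x - D (S.phi.app (S.hApp Z)) x := by
    intro Z hZ
    have h1 := S.phi.smoothAt_app hZ
    have h2 := S.phi.smoothAt_app (S.smoothAt_hApp hZ)
    rw [sub_eq_add_neg, conn_add D h1.neg.diffAt h2.neg.diffAt, conn_neg D h1.diffAt,
      conn_neg D h2.diffAt, sub_eq_add_neg]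
  rw [curvature, S.nabla_xi_field hD, S.nabla_xi_field hD, hφ hX, hφ hY, S.bracket_eq hD hX hY,
    S.nabla_xi hD]
  simp only [sub_apply, neg_apply]
  module

end Curvature

end ContactMetricStructure

/-! ### Consequences of the nullity condition: `h² = (κ-1)φ²` and `κ < 1`. -/

namespace ContactMetricStructure

/-- The `(κ, μ)`-nullity condition for the curvature of the connection `D`. -/
def NullityCondition (S : ContactMetricStructure n M) (D : Connection n M) (κ μ : ℝ) : Prop :=
  ∀ (x : M) (X Y : VField n M), SmoothAt X x → SmoothAt Y x →
    curvature D X Y S.xi.val x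
      = κ • (S.eta.val x (Y x) • X x - S.eta.val x (X x) • Y x)
        + μ • (S.eta.val x (Y x) • S.h x (X x) - S.eta.val x (X x) • S.h x (Y x))

variable (S : ContactMetricStructure n M) {D : Connection n M} {x : M} {κ μ : ℝ}
  (hD : IsLeviCivita S.g D) (hR : S.NullityCondition D κ μ)

include hD

theorem nabla_h_phi_xi {X : VField n M} (hX : SmoothAt X x) :
    D (S.hApp (S.phi.app X)) x (S.xi.val x) - S.h x (D (S.phi.app X) x (S.xi.val x))
      = - S.phi.val x (D (S.hApp X) x (S.xi.val x) - S.h x (D X x (S.xi.val x))) := by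
  have e : S.hApp (S.phi.app X) = - S.phi.app (S.hApp X) := by
    funext y
    exact S.h_phi hD (X y)
  have hh := S.smoothAt_hApp hX
  rw [e, conn_neg D (S.phi.smoothAt_app hh).diffAt, neg_apply, S.nablaPhi_xi hD hh,
    S.nablaPhi_xi hD hX, S.h_phi hD]
  simp only [map_sub]
  module

include hR

/-- The nullity condition for `R_{ξX}ξ`, with `∇ξ = -φ - φh` and `∇_ξ φ = 0` inserted. -/
theorem phi_nabla_h_xi {X : VField n M} (hX : SmoothAt X x) :
    S.phi.val x (D (S.hApp X) x (S.xi.val x) - S.h x (D X x (S.xi.val x)))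
      = (1 - κ) • S.phi.val x (S.phi.val x (X x)) + S.h x (S.h x (X x)) + μ • S.h x (X x) := by
  have hξ := S.xi.smooth x
  have h1 := (S.curvature_xi hD hξ hX).symm.trans (hR x S.xi.val X hξ hX)
  have e1 : S.phi.app S.xi.val = 0 := by
    funext y
    exact S.phi_xi y
  have e2 : S.phi.app (S.hApp S.xi.val) = 0 := by
    funext y
    simp only [EndField.app, hApp, S.h_xi hD, map_zero, Pi.zero_apply]
  have e3 : D 0 x = 0 := by simp
  rw [e1, e2, e3, S.nablaPhi_xi hD hX, S.nablaPhi_xi hD (S.smoothAt_hApp hX), S.nabla_xi hD,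
    S.eta_xi, S.h_xi hD] at h1
  have h2 : S.phi.val x (S.h x (S.phi.val x (S.h x (X x)))) = S.h x (S.h x (X x)) := by
    rw [S.h_phi hD, map_neg, S.phi_sq, S.eta_h hD, zero_smul, add_zero, neg_neg]
  have h3 := S.phi_sq x (X x)
  simp only [map_sub, map_neg, zero_apply, S.h_phi hD, S.eta_h hD, neg_neg,
    S.phi_sq x (S.h x _), zero_smul, add_zero, smul_zero, one_smul] at h1 h2 ⊢
  rw [h3] at h1 ⊢
  linear_combination (norm := module) (-1 : ℝ) • h1

/-- Both `h` and `∇_ξ h` anticommute with `φ`. Comparing `phi_nabla_h_xi` at `φX` with its image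
under `φ` at `X`, the `μ`-terms cancel and `φh² = (κ-1)φ³` remains. -/
theorem h_sq (v : Tan n M x) :
    S.h x (S.h x v) = (κ - 1) • S.phi.val x (S.phi.val x v) := by
  obtain ⟨X, hX, rfl⟩ := exists_smoothAt_eq x v
  have h1 := congrArg (S.phi.val x) (S.phi_nabla_h_xi hD hR hX)
  have h2 := S.phi_nabla_h_xi hD hR (S.phi.smoothAt_app hX)
  rw [S.nabla_h_phi_xi hD hX, map_neg, h1] at h2
  have h3 := congrArg (S.phi.val x) h2
  simp only [EndField.app, map_add, map_neg, map_smul, S.phi_cube, S.h_phi hD, neg_neg,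
    S.phi_sq x (S.h x _), S.eta_h hD, zero_smul, add_zero] at h3
  have h4 : (2 : ℝ) • (S.h x (S.h x (X x)) - (κ - 1) • S.phi.val x (S.phi.val x (X x))) = 0 := by
    linear_combination (norm := module) h3
  exact sub_eq_zero.1 ((smul_eq_zero.1 h4).resolve_left two_ne_zero)

theorem ip_h_self (v : Tan n M x) :
    S.ip x (S.h x v) (S.h x v)
      = (1 - κ) * S.ip x (S.phi.val x v) (S.phi.val x v) := by
  rw [S.h_symm hD, S.h_sq hD hR, ip_smul_right, ip_phi]
  ring

theorem h_eq_zero_of_one_le (hκ : 1 ≤ κ) (v : Tan n M x) : S.h x v = 0 := by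
  by_contra hne
  have h1 := S.ip_self_pos hne
  rw [S.ip_h_self hD hR] at h1
  have h2 : 0 ≤ S.ip x (S.phi.val x v) (S.phi.val x v) := by
    by_cases h0 : S.phi.val x v = 0
    · rw [h0, ip_zero_left]
    · exact (S.ip_self_pos h0).le
  nlinarith

theorem phi_eq_zero_of_one_lt (hκ : 1 < κ) (v : Tan n M x) : S.phi.val x v = 0 := by
  apply S.eq_zero_of_ip_self
  have h1 := S.ip_h_self hD hR v
  rw [S.h_eq_zero_of_one_le hD hR hκ.le, ip_zero_left] at h1
  exact (mul_eq_zero.1 h1.symm).resolve_left (by linarith)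

/-- Here `h = 0`, so the nullity condition gives `(∇_X φ)Y - (∇_Y φ)X`. The cyclic identity and the
skewness of `∇φ` then determine `∇φ` itself. -/
theorem nablaPhi_of_kappa_eq_one (hκ : κ = 1) {X Z : VField n M} (hX : SmoothAt X x)
    (hZ : SmoothAt Z x) :
    D (S.phi.app X) x (Z x)
      = S.phi.val x (D X x (Z x)) + S.ip x (X x) (Z x) • S.xi.val x
        - S.eta.val x (X x) • Z x := by
  have h0 : ∀ {y : M} (v : Tan n M y), S.h y v = 0 := S.h_eq_zero_of_one_le hD hR hκ.ge
  have hc : ∀ {U V : VField n M}, SmoothAt U x → SmoothAt V x →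
      - D (S.phi.app V) x (U x) + S.phi.val x (D V x (U x)) + D (S.phi.app U) x (V x)
        - S.phi.val x (D U x (V x)) = S.eta.val x (V x) • U x - S.eta.val x (U x) • V x := by
    intro U V hU hV
    have h1 := (S.curvature_xi hD hU hV).symm.trans (hR x U V hU hV)
    have e : ∀ W : VField n M, S.phi.app (S.hApp W) = 0 := by
      intro W
      funext y
      simp only [EndField.app, hApp, h0, map_zero, Pi.zero_apply]
    have e3 : D 0 x = 0 := by simp
    rw [e, e, e3, h0, h0, h0, hκ, map_sub] at h1
    simp only [zero_apply, map_zero, smul_zero, one_smul, add_zero, sub_zero] at h1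
    rw [← h1]
    abel
  refine S.eq_of_ip fun u => ?_
  obtain ⟨Y, hY, rfl⟩ := exists_smoothAt_eq x u
  have c1 := congrArg (fun v => S.ip x v (Z x)) (hc hX hY)
  have cyc := S.nablaPhi_cyclic hD hX hY hZ
  have s1 := S.nablaPhi_skew hD hX hZ (Y x)
  simp only [ip_sub_left, ip_add_left, ip_smul_left, ip_neg_left, xi_ip] at c1 cyc s1 ⊢
  rw [S.ip_comm x (Z x) (Y x)]
  linarith

theorem isSasakian_of_kappa_eq_one (hκ : κ = 1) : S.IsSasakian := by
  intro x X Y hX hY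
  have hφX := S.phi.smoothAt_app hX
  have hφY := S.phi.smoothAt_app hY
  have f1 := S.nablaPhi_of_kappa_eq_one hD hR hκ hX hY
  have f2 := S.nablaPhi_of_kappa_eq_one hD hR hκ hY hX
  have f3 := S.nablaPhi_of_kappa_eq_one hD hR hκ hX hφY
  have f4 := S.nablaPhi_of_kappa_eq_one hD hR hκ hY hφX
  have e := S.d_eta x (X x) (Y x)
  have e1 := S.ip_phi x (X x) (Y x)
  rw [nijenhuis, S.bracket_eq hD hX hY, S.bracket_eq hD hφX hφY, S.bracket_eq hD hφX hY,
    S.bracket_eq hD hX hφY, e, f1, f2, f3, f4]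
  change _ + (2 * S.ip x (X x) (S.phi.val x (Y x))) • _ = _
  simp only [EndField.app, map_sub, map_add, map_smul, S.phi_xi]
  rw [S.ip_comm x (Y x), e1]
  module

theorem kappa_lt_one (hS : ¬ S.IsSasakian) : κ < 1 := by
  by_contra hκ
  rcases (not_lt.1 hκ).eq_or_lt with h | h
  · exact hS (S.isSasakian_of_kappa_eq_one hD hR h.symm)
  · exact hS (S.isSasakian_of_phi_eq_zero fun _ => S.phi_eq_zero_of_one_lt hD hR h)

end ContactMetricStructure

/-! ### Eigenvectors of `h` and their extension to eigenfields. -/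

namespace ContactMetricStructure

variable (S : ContactMetricStructure n M) {D : Connection n M} {x : M} {κ μ c : ℝ}

theorem mem_eigenDist {v : Tan n M x} : v ∈ S.eigenDist c x ↔ S.h x v = c • v :=
  Module.End.mem_eigenspace_iff

section

variable (hD : IsLeviCivita S.g D)

include hD

theorem eta_eq_zero_of_h (hc : c ≠ 0) {v : Tan n M x} (hv : S.h x v = c • v) :
    S.eta.val x v = 0 := by
  have h := S.eta_h hD v
  rw [hv, map_smul, smul_eq_mul] at h
  exact (mul_eq_zero.1 h).resolve_left hc

theorem h_phi_of_h {v : Tan n M x} (hv : S.h x v = c • v) :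
    S.h x (S.phi.val x v) = (-c) • S.phi.val x v := by
  rw [S.h_phi hD, hv, map_smul, neg_smul]

theorem phi_phi_of_h (hc : c ≠ 0) {v : Tan n M x} (hv : S.h x v = c • v) :
    S.phi.val x (S.phi.val x v) = - v := by
  rw [S.phi_sq, S.eta_eq_zero_of_h hD hc hv, zero_smul, add_zero]

theorem ip_phi_phi_of_h (hc : c ≠ 0) {v : Tan n M x} (hv : S.h x v = c • v) (w : Tan n M x) :
    S.ip x (S.phi.val x v) (S.phi.val x w) = S.ip x v w := by
  rw [S.ip_comm, ip_phi, S.phi_phi_of_h hD hc hv, ip_neg_right, neg_neg, ip_comm]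

theorem ip_eq_zero_of_h (hc : c ≠ 0) {v w : Tan n M x} (hv : S.h x v = c • v)
    (hw : S.h x w = (-c) • w) : S.ip x v w = 0 := by
  have h := S.h_symm hD v w
  rw [hv, hw, ip_smul_left, ip_smul_right] at h
  have : 2 * c * S.ip x v w = 0 := by linarith
  exact (mul_eq_zero.1 this).resolve_left (mul_ne_zero two_ne_zero hc)

end

section Projection

variable (c) in
/-- The projection onto the eigenspace of `h` for `c`, if `h³ = c² h`. -/
def eigenProj (X : VField n M) : VField n M :=
  (1 / (2 * c ^ 2)) • (S.hApp (S.hApp X) + c • S.hApp X)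

theorem eigenProj_apply (X : VField n M) (y : M) :
    S.eigenProj c X y = (1 / (2 * c ^ 2)) • (S.h y (S.h y (X y)) + c • S.h y (X y)) := rfl

theorem smoothAt_eigenProj {X : VField n M} (hX : SmoothAt X x) :
    SmoothAt (S.eigenProj c X) x :=
  SmoothAt.const_smul _ ((S.smoothAt_hApp (S.smoothAt_hApp hX)).add
    (SmoothAt.const_smul c (S.smoothAt_hApp hX)))

theorem eigenProj_of_h (hc : c ≠ 0) {X : VField n M} (hX : S.h x (X x) = c • X x) :
    S.eigenProj c X x = X x := by
  rw [eigenProj_apply, hX, map_smul, hX, smul_smul, ← add_smul, smul_smul]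
  have : 1 / (2 * c ^ 2) * (c * c + c * c) = 1 := by field_simp; ring
  rw [this, one_smul]

variable (hD : IsLeviCivita S.g D) (hR : S.NullityCondition D κ μ)

include hD hR

theorem h_cube (hcκ : c ^ 2 = 1 - κ) (v : Tan n M x) :
    S.h x (S.h x (S.h x v)) = c ^ 2 • S.h x v := by
  rw [S.h_sq hD hR, S.phi_sq, S.eta_h hD, zero_smul, add_zero, hcκ]
  module

theorem h_sq_of_eta (hcκ : c ^ 2 = 1 - κ) {v : Tan n M x} (hv : S.eta.val x v = 0) :
    S.h x (S.h x v) = c ^ 2 • v := by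
  rw [S.h_sq hD hR, S.phi_sq, hv, zero_smul, add_zero, hcκ]
  module

theorem h_eigenProj (hcκ : c ^ 2 = 1 - κ) (X : VField n M) (y : M) :
    S.h y (S.eigenProj c X y) = c • S.eigenProj c X y := by
  rw [eigenProj_apply, map_smul, map_add, map_smul, S.h_cube hD hR hcκ]
  module

/-- The projection replaces a local section by a field with the same germ that satisfies `hY = cY`
everywhere, so that the relation is an equality of fields. -/
theorem exists_eigenfield_of_section (hc : c ≠ 0) (hcκ : c ^ 2 = 1 - κ) {X : VField n M}
    (hX : IsSectionAt (S.eigenDist c) X x) :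
    ∃ Y : VField n M, SmoothAt Y x ∧ (∀ y, S.h y (Y y) = c • Y y) ∧
      ∀ᶠ y in nhds x, X y = Y y := by
  refine ⟨S.eigenProj c X, S.smoothAt_eigenProj hX.1, S.h_eigenProj hD hR hcκ X, ?_⟩
  filter_upwards [hX.2] with y hy
  exact (S.eigenProj_of_h hc (S.mem_eigenDist.1 hy)).symm

theorem exists_eigenfield_of_mem (hc : c ≠ 0) (hcκ : c ^ 2 = 1 - κ) {v : Tan n M x}
    (hv : S.h x v = c • v) :
    ∃ Y : VField n M, SmoothAt Y x ∧ (∀ y, S.h y (Y y) = c • Y y) ∧ Y x = v := by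
  obtain ⟨X, hX, rfl⟩ := exists_smoothAt_eq x v
  exact ⟨S.eigenProj c X, S.smoothAt_eigenProj hX, S.h_eigenProj hD hR hcκ X,
    S.eigenProj_of_h hc hv⟩

end Projection

/-! ### Rank of the eigendistributions -/

section Rank

variable (hD : IsLeviCivita S.g D) (hR : S.NullityCondition D κ μ)

omit [IsManifold (𝓡 (2 * n + 1)) ∞ M] in
theorem finrank_tan (x : M) : Module.finrank ℝ (Tan n M x) = 2 * n + 1 := by
  change Module.finrank ℝ (EuclideanSpace ℝ (Fin (2 * n + 1))) = 2 * n + 1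
  simp

instance (x : M) : FiniteDimensional ℝ (Tan n M x) :=
  inferInstanceAs (FiniteDimensional ℝ (EuclideanSpace ℝ (Fin (2 * n + 1))))

include hD

/-- `φ` carries `𝒟(c)` onto `𝒟(-c)`. Used for `c` and for `-c`, this gives equal ranks. -/
theorem finrank_eigenDist_neg_le (hc : c ≠ 0) :
    Module.finrank ℝ (S.eigenDist (-c) x) ≤ Module.finrank ℝ (S.eigenDist c x) := by
  have hle : S.eigenDist (-c) x
      ≤ (S.eigenDist c x).map (S.phi.val x : Tan n M x →ₗ[ℝ] Tan n M x) := by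
    intro v hv
    rw [mem_eigenDist] at hv
    refine ⟨- S.phi.val x v, ?_, ?_⟩
    · have h1 := S.h_phi_of_h hD hv
      rw [neg_neg] at h1
      change _ ∈ S.eigenDist c x
      rw [mem_eigenDist, map_neg, h1, smul_neg]
    · change S.phi.val x (- S.phi.val x v) = v
      rw [map_neg, S.phi_phi_of_h hD (neg_ne_zero.2 hc) hv, neg_neg]
  exact (Submodule.finrank_mono hle).trans (Submodule.finrank_map_le _ _)

theorem eigenDist_inf_neg (hc : c ≠ 0) : S.eigenDist c x ⊓ S.eigenDist (-c) x = ⊥ := by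
  rw [eq_bot_iff]
  rintro v ⟨h1, h2⟩
  exact S.eq_zero_of_ip_self (S.ip_eq_zero_of_h hD hc (S.mem_eigenDist.1 h1)
    (S.mem_eigenDist.1 h2))

include hR

theorem eigenDist_sup_neg (hc : c ≠ 0) (hcκ : c ^ 2 = 1 - κ) :
    S.eigenDist c x ⊔ S.eigenDist (-c) x
      = LinearMap.ker (S.eta.val x : Tan n M x →ₗ[ℝ] ℝ) := by
  apply le_antisymm
  · refine sup_le (fun v hv => ?_) fun v hv => ?_
    · exact S.eta_eq_zero_of_h hD hc (S.mem_eigenDist.1 hv)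
    · exact S.eta_eq_zero_of_h hD (neg_ne_zero.2 hc) (S.mem_eigenDist.1 hv)
  · intro v hv
    have hv : S.eta.val x v = 0 := hv
    have h2 := S.h_sq_of_eta hD hR hcκ hv
    rw [Submodule.mem_sup]
    -- On `ker η` one has `(h/c)² = 1`; these are the projections `½(1 ± h/c)v`.
    refine ⟨(1 / 2 : ℝ) • v + (1 / (2 * c)) • S.h x v, ?_,
      (1 / 2 : ℝ) • v - (1 / (2 * c)) • S.h x v, ?_, by module⟩
    · rw [mem_eigenDist, map_add, map_smul, map_smul, h2]
      match_scalars <;> field_simp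
    · rw [mem_eigenDist, map_sub, map_smul, map_smul, h2]
      match_scalars <;> field_simp

theorem finrank_eigenDist (hc : c ≠ 0) (hcκ : c ^ 2 = 1 - κ) :
    Module.finrank ℝ (S.eigenDist c x) = n := by
  have h1 := S.finrank_eigenDist_neg_le (x := x) hD hc
  have h2 := S.finrank_eigenDist_neg_le (x := x) hD (neg_ne_zero.2 hc)
  rw [neg_neg] at h2
  have h3 := Submodule.finrank_sup_add_finrank_inf_eq (S.eigenDist c x) (S.eigenDist (-c) x)
  rw [S.eigenDist_inf_neg hD hc, S.eigenDist_sup_neg hD hR hc hcκ, finrank_bot] at h3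
  have h4 := LinearMap.finrank_range_add_finrank_ker (S.eta.val x : Tan n M x →ₗ[ℝ] ℝ)
  have h5 : LinearMap.range (S.eta.val x : Tan n M x →ₗ[ℝ] ℝ) = ⊤ := by
    rw [LinearMap.range_eq_top]
    intro r
    refine ⟨r • S.xi.val x, ?_⟩
    change S.eta.val x (r • S.xi.val x) = r
    rw [map_smul, S.eta_xi, smul_eq_mul, mul_one]
  rw [h5, finrank_top, finrank_tan, Module.finrank_self] at h4
  omega

end Rank

/-! ### Pang's invariant of the eigendistributions -/

section Pang

variable (hD : IsLeviCivita S.g D) (hR : S.NullityCondition D κ μ)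

include hD hR

/-- For `hX = cX`, `phi_nabla_h_xi` reads `φ(c - h)∇_ξ X = μcX`. Pairing with `w` moves `φ` and `c -
h` onto `w`, and `c - h` acts on `φw` as `2c`. -/
theorem ip_nabla_eigenfield_phi (hc : c ≠ 0) (hcκ : c ^ 2 = 1 - κ) {X : VField n M}
    (hX : SmoothAt X x) (hXc : ∀ y, S.h y (X y) = c • X y) {w : Tan n M x}
    (hw : S.h x w = c • w) :
    S.ip x (D X x (S.xi.val x)) (S.phi.val x w) = - (μ / 2) * S.ip x (X x) w := by
  have h1 := congrArg (fun v => S.ip x v w) (S.phi_nabla_h_xi hD hR hX)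
  have e : S.hApp X = c • X := by
    funext y
    exact hXc y
  rw [e, conn_const_smul D c hX.diffAt, S.h_sq_of_eta hD hR hcκ (S.eta_eq_zero_of_h hD hc (hXc x)),
    S.phi_phi_of_h hD hc (hXc x), hXc x] at h1
  simp only [ip_phi, ip_sub_left, ip_add_left, ip_smul_left, ip_neg_left, smul_apply,
    S.h_symm hD, S.h_phi_of_h hD hw, ip_smul_right] at h1
  have h2 : c * (2 * S.ip x (D X x (S.xi.val x)) (S.phi.val x w) + μ * S.ip x (X x) w) = 0 := by
    rw [← hcκ] at h1
    linear_combination -h1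
  have h3 := (mul_eq_zero.1 h2).resolve_left hc
  linarith

/-- In `[ξ, X] = ∇_ξ X - ∇_X ξ` the first term contributes `-μ/2`, and the second `1 + c` since `∇_X
ξ = -(1 + c)φX`. -/
theorem pang_eigenfield (hc : c ≠ 0) (hcκ : c ^ 2 = 1 - κ) {X Y : VField n M}
    (hX : IsSectionAt (S.eigenDist c) X x) (hY : IsSectionAt (S.eigenDist c) Y x) :
    S.pang X Y x = 2 * (1 + c - μ / 2) * S.ip x (X x) (Y x) := by
  obtain ⟨Z, hZ, hZc, hXZ⟩ := S.exists_eigenfield_of_section hD hR hc hcκ hX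
  have hw := S.mem_eigenDist.1 hY.2.self_of_nhds
  have e : ∀ v w : Tan n M x, S.eta.d x v w = S.ip x v (S.phi.val x w) := S.d_eta x
  rw [pang, bracket_congr_right hXZ, S.bracket_eq hD (S.xi.smooth x) hZ, S.nabla_xi hD, e,
    hXZ.self_of_nhds, hZc x]
  simp only [ip_sub_left, ip_neg_left, map_smul, ip_smul_left, S.ip_phi_phi_of_h hD hc (hZc x),
    S.ip_nabla_eigenfield_phi hD hR hc hcκ hZ hZc hw]
  ring

end Pang

end ContactMetricStructure

namespace ContactMetricStructure

variable (S : ContactMetricStructure n M) {D : Connection n M} {x : M} {κ μ c : ℝ}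

/-- `X` is smooth near `x` and `h X = c X` everywhere. -/
structure IsEigenfield (c : ℝ) (X : VField n M) (x : M) : Prop where
  smooth : SmoothAt X x
  h_apply : ∀ y, S.h y (X y) = c • X y

/-! ### Covariant derivatives of eigenfields of `h` -/

section

variable {S} (hD : IsLeviCivita S.g D) {X Y : VField n M}

include hD

theorem IsEigenfield.phi (hX : S.IsEigenfield c X x) : S.IsEigenfield (-c) (S.phi.app X) x :=
  ⟨S.phi.smoothAt_app hX.smooth, fun y => S.h_phi_of_h hD (hX.h_apply y)⟩

theorem IsEigenfield.conn_phi_phi (hX : S.IsEigenfield c X x) (hc : c ≠ 0) :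
    D (S.phi.app (S.phi.app X)) x = - D X x := by
  have e : S.phi.app (S.phi.app X) = -X := by
    funext y
    exact S.phi_phi_of_h hD hc (hX.h_apply y)
  rw [e, conn_neg D hX.smooth.diffAt]

theorem IsEigenfield.ip_conn_add (hX : S.IsEigenfield c X x) (hY : S.IsEigenfield (-c) Y x)
    (hc : c ≠ 0) (u : Tan n M x) :
    S.ip x (D X x u) (Y x) + S.ip x (D Y x u) (X x) = 0 := by
  have h := S.dirD_ip hD hX.smooth hY.smooth u
  have e : (fun y => S.ip y (X y) (Y y)) = fun _ => (0 : ℝ) := by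
    funext y
    exact S.ip_eq_zero_of_h hD hc (hX.h_apply y) (hY.h_apply y)
  rw [e, S.ip_comm x (X x)] at h
  simp only [dirD, mvfderiv_const, zero_apply] at h
  exact h.symm

theorem IsEigenfield.ip_conn_phi_phi (hX : S.IsEigenfield c X x) (hY : S.IsEigenfield c Y x)
    (hc : c ≠ 0) (u : Tan n M x) :
    S.ip x (D (S.phi.app X) x u) (S.phi.val x (Y x))
      + S.ip x (D (S.phi.app Y) x u) (S.phi.val x (X x))
      = S.ip x (D X x u) (Y x) + S.ip x (D Y x u) (X x) := by
  have h := S.dirD_ip hD hX.smooth hY.smooth u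
  have h' := S.dirD_ip hD (hX.phi hD).smooth (hY.phi hD).smooth u
  have e : (fun y => S.ip y (S.phi.app X y) (S.phi.app Y y)) = fun y => S.ip y (X y) (Y y) := by
    funext y
    exact S.ip_phi_phi_of_h hD hc (hX.h_apply y) (Y y)
  rw [e, h, S.ip_comm x (X x), S.ip_comm x (S.phi.app X x)] at h'
  exact h'.symm

/-- Eigenfields for nonzero eigenvalues lie in `ker η`, so the nullity condition becomes `R_{XY}ξ =
0`. -/
theorem IsEigenfield.conn_eq_of_nullity (hR : S.NullityCondition D κ μ) {a b : ℝ} (ha : a ≠ 0)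
    (hb : b ≠ 0) (hX : S.IsEigenfield a X x) (hY : S.IsEigenfield b Y x) :
    (1 + b) • D (S.phi.app Y) x (X x) - (1 + a) • D (S.phi.app X) x (Y x)
      = S.phi.val x (D Y x (X x) - D X x (Y x))
        + S.phi.val x (S.h x (D Y x (X x) - D X x (Y x))) := by
  have h := (S.curvature_xi hD hX.smooth hY.smooth).symm.trans (hR x X Y hX.smooth hY.smooth)
  have e : ∀ {a : ℝ} {Z : VField n M}, S.IsEigenfield a Z x →
      D (S.phi.app (S.hApp Z)) x = a • D (S.phi.app Z) x := by
    intro a Z hZ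
    have e1 : S.phi.app (S.hApp Z) = a • S.phi.app Z := by
      funext y
      change S.phi.val y (S.h y (Z y)) = a • S.phi.val y (Z y)
      rw [hZ.h_apply y, map_smul]
    rw [e1, conn_const_smul D a (hZ.phi hD).smooth.diffAt]
  rw [e hX, e hY, S.eta_eq_zero_of_h hD ha (hX.h_apply x),
    S.eta_eq_zero_of_h hD hb (hY.h_apply x)] at h
  simp only [smul_apply, zero_smul, sub_self, smul_zero, add_zero] at h
  linear_combination (norm := module) (-1 : ℝ) • h

/-- The leaves of `𝒟(c)` are totally geodesic within `ker η`. Factors `1 ± c` are never divided out,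
only `c`, so `c = ±1` needs no separate treatment. -/
theorem IsEigenfield.ip_conn_phi_eq_zero (hR : S.NullityCondition D κ μ) (hc : c ≠ 0)
    {Z : VField n M} (hX : S.IsEigenfield c X x) (hY : S.IsEigenfield c Y x)
    (hZ : S.IsEigenfield c Z x) :
    S.ip x (D Y x (X x)) (S.phi.val x (Z x)) = 0 := by
  have hc' : -c ≠ 0 := neg_ne_zero.2 hc
  obtain ⟨a, ha⟩ : ∃ a : VField n M → VField n M → VField n M → ℝ,
      ∀ X Y Z, a X Y Z = S.ip x (D Y x (X x)) (S.phi.val x (Z x)) := ⟨_, fun _ _ _ => rfl⟩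
  -- On eigenfields `C U V W` is `g((∇_{φU} φ)V, φW)`, the part of `∇φ` in directions of `𝒟(-c)`.
  obtain ⟨C, hC⟩ : ∃ C : VField n M → VField n M → VField n M → ℝ,
      ∀ X Y Z, C X Y Z = S.ip x (D (S.phi.app Y) x (S.phi.val x (X x))) (S.phi.val x (Z x))
        - S.ip x (D Y x (S.phi.val x (X x))) (Z x) := ⟨_, fun _ _ _ => rfl⟩
  have skew_a : ∀ {U V W}, S.IsEigenfield c U x → S.IsEigenfield c V x → S.IsEigenfield c W x →
      S.ip x (D (S.phi.app V) x (U x)) (W x) = - a U W V := by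
    intro U V W _ hV hW
    have h := hW.ip_conn_add hD (hV.phi hD) hc (U x)
    rw [ha]
    exact eq_neg_of_add_eq_zero_right h
  have skew_C : ∀ {U V W}, S.IsEigenfield c U x → S.IsEigenfield c V x → S.IsEigenfield c W x →
      C U V W = - C U W V := by
    intro U V W _ hV hW
    have h := hV.ip_conn_phi_phi hD hW hc (S.phi.val x (U x))
    rw [hC, hC]
    linarith
  -- `r1`, `r2`, `r3` are the relation `R ξ = 0` on the pairs `(U, V)`, `(φU, φV)`, `(V, φW)`,
  -- tested against `W`, `W`, `φU`; `cyc` is the closedness of `dη` on `(φU, V, φW)`.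
  have r1 : ∀ {U V W}, S.IsEigenfield c U x → S.IsEigenfield c V x → S.IsEigenfield c W x →
      (1 + c) * (a U W V - a V W U) = (1 - c) * (a U V W - a V U W) := by
    intro U V W hU hV hW
    have h := congrArg (fun v => S.ip x v (W x)) (hU.conn_eq_of_nullity hD hR hc hc hV)
    simp only [ip_sub_left, ip_add_left, ip_smul_left, ip_phi, S.h_symm hD,
      S.h_phi_of_h hD (hW.h_apply x), ip_smul_right, skew_a hU hV hW, skew_a hV hU hW, ← ha] at h
    linarith
  have r2 : ∀ {U V W}, S.IsEigenfield c U x → S.IsEigenfield c V x → S.IsEigenfield c W x →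
      (1 - c) * (C U V W - C V U W) = 0 := by
    intro U V W hU hV hW
    have h := congrArg (fun v => S.ip x v (W x))
      ((hU.phi hD).conn_eq_of_nullity hD hR hc' hc' (hV.phi hD))
    rw [hU.conn_phi_phi hD hc, hV.conn_phi_phi hD hc] at h
    simp only [ip_sub_left, ip_add_left, ip_smul_left, ip_neg_left, ip_phi, S.h_symm hD,
      S.h_phi_of_h hD (hW.h_apply x), ip_smul_right, neg_apply, EndField.app] at h
    rw [hC, hC]
    linarith
  have r3 : ∀ {U V W}, S.IsEigenfield c U x → S.IsEigenfield c V x → S.IsEigenfield c W x →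
      (1 + c) * C W V U = (1 + c) * a V U W - (1 - c) * a V W U := by
    intro U V W hU hV hW
    have h := congrArg (fun v => S.ip x v (S.phi.val x (U x)))
      (hV.conn_eq_of_nullity hD hR hc hc' (hW.phi hD))
    rw [hW.conn_phi_phi hD hc] at h
    simp only [ip_sub_left, ip_add_left, ip_smul_left, ip_neg_left, S.ip_phi x (_ - _),
      S.ip_phi x (S.h x _), S.h_symm hD, map_neg, ip_neg_right, neg_apply,
      S.phi_phi_of_h hD hc (hU.h_apply x), hU.h_apply x, ip_smul_right,
      skew_a hV hW hU, EndField.app, ← ha] at h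
    rw [hC]
    linarith
  have cyc : ∀ {U V W}, S.IsEigenfield c U x → S.IsEigenfield c V x → S.IsEigenfield c W x →
      C U V W + C W U V = a V W U - a V U W := by
    intro U V W hU hV hW
    have h := S.nablaPhi_cyclic hD (hU.phi hD).smooth hV.smooth (hW.phi hD).smooth
    rw [hU.conn_phi_phi hD hc, hW.conn_phi_phi hD hc] at h
    simp only [ip_sub_left, ip_neg_left, ip_phi, neg_apply, EndField.app, ip_neg_right,
      S.phi_phi_of_h hD hc (hU.h_apply x), S.phi_phi_of_h hD hc (hW.h_apply x),
      skew_a hV hW hU, ← ha] at h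
    rw [hC, hC]
    linarith
  -- `cyc` and `skew_C` express the defect of `a` under exchange of its last two arguments through
  -- the left side of `r2`.
  have f1 : ∀ {U V W}, S.IsEigenfield c U x → S.IsEigenfield c V x → S.IsEigenfield c W x →
      (1 - c) * (a U V W - a U W V) = 0 := by
    intro U V W hU hV hW
    have h1 := r2 hV hW hU
    have h2 := cyc hV hU hW
    have h3 := skew_C hV hU hW
    have h4 := skew_C hW hU hV
    have h5 : C V W U - C W V U = - (a U W V - a U V W) := by linarith
    rw [h5] at h1
    linarith
  have f2 : ∀ {U V W}, S.IsEigenfield c U x → S.IsEigenfield c V x → S.IsEigenfield c W x →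
      a U V W = - a V U W := by
    intro U V W hU hV hW
    have h1 := r3 hU hV hW
    have h2 := r3 hV hU hW
    have h3 := f1 hV hU hW
    have h4 := f1 hU hV hW
    rw [skew_C hW hV hU] at h1
    have h5 : c * (a U V W + a V U W) = 0 := by linarith
    exact eq_neg_of_add_eq_zero_left ((mul_eq_zero.1 h5).resolve_left hc)
  have f3 : ∀ {U V W}, S.IsEigenfield c U x → S.IsEigenfield c V x → S.IsEigenfield c W x →
      a U W V = a V W U := by
    intro U V W hU hV hW
    have h1 := r1 hU hV hW
    have h3 := f1 hV hU hW
    have h4 := f1 hU hV hW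
    have h5 : c * (a U W V - a V W U) = 0 := by linarith
    exact sub_eq_zero.1 ((mul_eq_zero.1 h5).resolve_left hc)
  rw [← ha]
  -- `a` is skew in its first two arguments and symmetric in the first and third. These
  -- transpositions are conjugate in `S₃`, so `a` changes sign and does not under the remaining one.
  linarith [f3 hX hZ hY, f2 hZ hY hX, f3 hY hX hZ, f2 hX hZ hY, f3 hZ hY hX, f2 hY hX hZ]

theorem IsEigenfield.conn_mem (hR : S.NullityCondition D κ μ) (hc : c ≠ 0)
    (hcκ : c ^ 2 = 1 - κ) (hX : S.IsEigenfield c X x) (hY : S.IsEigenfield c Y x) :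
    D Y x (X x) ∈ S.eigenDist c x := by
  rw [mem_eigenDist]
  have hη : S.eta.val x (D Y x (X x)) = 0 := by
    have h := S.dirD_eta hD hY.smooth (X x)
    have e : (fun y => S.eta.val y (Y y)) = fun _ => (0 : ℝ) := by
      funext y
      exact S.eta_eq_zero_of_h hD hc (hY.h_apply y)
    have h0 := S.ip_eq_zero_of_h hD hc (hY.h_apply x) (S.h_phi_of_h hD (hX.h_apply x))
    rw [e, S.nabla_xi hD, hX.h_apply x, map_smul, ip_sub_right, ip_neg_right, ip_smul_right,
      h0] at h
    simp only [dirD, mvfderiv_const, zero_apply] at h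
    linarith
  set w := D Y x (X x) with hw
  -- `v` is, up to the factor `-2c`, the `𝒟(-c)`-component of `w`; so `φv` lies in `𝒟(c)` and can
  -- serve as test vector.
  set v := S.h x w - c • w with hv
  have hhv : S.h x v = (-c) • v := by
    rw [hv, map_sub, map_smul, S.h_sq_of_eta hD hR hcκ hη]
    module
  have hφv := S.h_phi_of_h hD hhv
  rw [neg_neg] at hφv
  obtain ⟨Z, hZ, hZc, hZv⟩ := S.exists_eigenfield_of_mem hD hR hc hcκ hφv
  have h1 := hX.ip_conn_phi_eq_zero hD hR hc hY ⟨hZ, hZc⟩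
  rw [hZv, S.phi_phi_of_h hD (neg_ne_zero.2 hc) hhv, ip_neg_right, ← hw] at h1
  refine sub_eq_zero.1 (S.eq_zero_of_ip_self ?_)
  rw [← hv]
  nth_rewrite 1 [hv]
  rw [ip_sub_left, S.h_symm hD, hhv, ip_smul_left, ip_smul_right]
  linear_combination (2 * c) * h1

theorem isLegendreFoliation_eigenDist (hR : S.NullityCondition D κ μ) (hc : c ≠ 0)
    (hcκ : c ^ 2 = 1 - κ) : S.IsLegendreFoliation (S.eigenDist c) where
  rank _ := S.finrank_eigenDist hD hR hc hcκ
  smooth x v hv := by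
    obtain ⟨X, hX, hXc, hXv⟩ := S.exists_eigenfield_of_mem hD hR hc hcκ (S.mem_eigenDist.1 hv)
    exact ⟨X, ⟨hX, Filter.Eventually.of_forall fun y => S.mem_eigenDist.2 (hXc y)⟩, hXv⟩
  le_ker x v hv := S.eta_eq_zero_of_h hD hc (S.mem_eigenDist.1 hv)
  isotropic x v hv w hw := (S.d_eta x v w).trans
    (S.ip_eq_zero_of_h hD hc (S.mem_eigenDist.1 hv) (S.h_phi_of_h hD (S.mem_eigenDist.1 hw)))
  involutive x X Y hX hY := by
    obtain ⟨U, hU, hUc, hXU⟩ := S.exists_eigenfield_of_section hD hR hc hcκ hX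
    obtain ⟨V, hV, hVc, hYV⟩ := S.exists_eigenfield_of_section hD hR hc hcκ hY
    rw [bracket_congr_right hYV, bracket_swap, bracket_congr_right hXU, ← bracket_swap,
      S.bracket_eq hD hU hV]
    have hU' : S.IsEigenfield c U x := ⟨hU, hUc⟩
    have hV' : S.IsEigenfield c V x := ⟨hV, hVc⟩
    exact Submodule.sub_mem _ (hU'.conn_mem hD hR hc hcκ hV') (hV'.conn_mem hD hR hc hcκ hU')

end

/-! ### Definiteness of Pang's invariant of the eigendistributions -/

section Classes

variable (hD : IsLeviCivita S.g D) (hR : S.NullityCondition D κ μ)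

include hD hR

/-- Guards against vacuous definiteness. If `n = 0` then `ker η = 0`; it contains the image of `φ`,
so `φ = 0` and the structure would be Sasakian. -/
theorem exists_section_ne_zero (hS : ¬ S.IsSasakian) (hc : c ≠ 0) (hcκ : c ^ 2 = 1 - κ) :
    ∃ (x : M) (X : VField n M), IsSectionAt (S.eigenDist c) X x ∧ X x ≠ 0 := by
  obtain ⟨x, v, hv⟩ : ∃ x : M, ∃ v : Tan n M x, S.phi.val x v ≠ 0 := by
    by_contra! h0
    exact hS (S.isSasakian_of_phi_eq_zero h0)
  have hn : n ≠ 0 := by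
    rintro rfl
    have h1 := S.eigenDist_sup_neg (x := x) hD hR hc hcκ
    have hb : ∀ {c : ℝ}, c ≠ 0 → c ^ 2 = 1 - κ → S.eigenDist c x = ⊥ := fun h h' =>
      Submodule.finrank_eq_zero.1 (S.finrank_eigenDist hD hR h h')
    rw [hb hc hcκ, hb (neg_ne_zero.2 hc) (by rw [neg_sq, hcκ]), bot_sup_eq] at h1
    have h2 : S.phi.val x v ∈ LinearMap.ker (S.eta.val x : Tan 0 M x →ₗ[ℝ] ℝ) := S.eta_phi x v
    rw [← h1] at h2
    exact hv h2
  have hbot : S.eigenDist c x ≠ ⊥ := by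
    intro h
    have h1 := S.finrank_eigenDist (x := x) hD hR hc hcκ
    rw [h, finrank_bot] at h1
    exact hn h1.symm
  obtain ⟨w, hw, hw0⟩ := Submodule.exists_mem_ne_zero_of_ne_bot hbot
  obtain ⟨X, hX, hXw⟩ := (isLegendreFoliation_eigenDist hD hR hc hcκ).smooth x w hw
  exact ⟨x, X, hX, hXw ▸ hw0⟩

theorem positiveDefinite_iff (hS : ¬ S.IsSasakian) (hc : c ≠ 0) (hcκ : c ^ 2 = 1 - κ) :
    S.PositiveDefinite (S.eigenDist c) ↔ 0 < 1 + c - μ / 2 := by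
  constructor
  · intro h
    obtain ⟨x, X, hX, hX0⟩ := S.exists_section_ne_zero hD hR hS hc hcκ
    have h1 := h x X hX hX0
    rw [S.pang_eigenfield hD hR hc hcκ hX hX] at h1
    linarith [pos_of_mul_pos_left h1 (S.ip_self_pos hX0).le]
  · intro h x X hX hX0
    rw [S.pang_eigenfield hD hR hc hcκ hX hX]
    exact mul_pos (by linarith) (S.ip_self_pos hX0)

theorem negativeDefinite_iff (hS : ¬ S.IsSasakian) (hc : c ≠ 0) (hcκ : c ^ 2 = 1 - κ) :
    S.NegativeDefinite (S.eigenDist c) ↔ 1 + c - μ / 2 < 0 := by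
  constructor
  · intro h
    obtain ⟨x, X, hX, hX0⟩ := S.exists_section_ne_zero hD hR hS hc hcκ
    have h1 := h x X hX hX0
    rw [S.pang_eigenfield hD hR hc hcκ hX hX] at h1
    linarith [neg_of_mul_neg_left h1 (S.ip_self_pos hX0).le]
  · intro h x X hX hX0
    rw [S.pang_eigenfield hD hR hc hcκ hX hX]
    exact mul_neg_of_neg_of_pos (by linarith) (S.ip_self_pos hX0)

theorem flat_iff (hS : ¬ S.IsSasakian) (hc : c ≠ 0) (hcκ : c ^ 2 = 1 - κ) :
    S.Flat (S.eigenDist c) ↔ 1 + c - μ / 2 = 0 := by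
  constructor
  · intro h
    obtain ⟨x, X, hX, hX0⟩ := S.exists_section_ne_zero hD hR hS hc hcκ
    have h1 := h x X X hX hX
    rw [S.pang_eigenfield hD hR hc hcκ hX hX] at h1
    linarith [(mul_eq_zero.1 h1).resolve_right (S.ip_self_pos hX0).ne']
  · intro h x X Y hX hY
    rw [S.pang_eigenfield hD hR hc hcκ hX hY, h, mul_zero, zero_mul]

end Classes

end ContactMetricStructure

end ContactKM

end

/-- Dividing by `λ > 0`, the sign of `1 + λ - μ/2` is that of `I_M + 1`, and the sign of `1 - λ -
μ/2` is that of `I_M - 1`. The five classes thus cut the real line at `±1`, and both signs cannot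
vanish together. -/
theorem mainTheorem1 {n : ℕ} {M : Type*} [TopologicalSpace M]
    [ChartedSpace (ContactKM.Model n) M]
    [IsManifold (𝓡 (2 * n + 1)) ∞ M]
    (S : ContactKM.ContactMetricStructure n M) (κ μ : ℝ)
    (hκμ : S.IsKappaMu κ μ) (hS : ¬ S.IsSasakian) :
    κ < 1 ∧
    S.IsBiLegendrian (S.eigenDist (√(1 - κ))) (S.eigenDist (-√(1 - κ))) ∧
    ¬ (S.Flat (S.eigenDist (√(1 - κ))) ∧ S.Flat (S.eigenDist (-√(1 - κ)))) ∧
    (∃! c : ContactKM.PangClass,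
      S.HasClass (S.eigenDist (√(1 - κ))) (S.eigenDist (-√(1 - κ))) c) ∧
    (S.HasClass (S.eigenDist (√(1 - κ))) (S.eigenDist (-√(1 - κ))) .I ↔
      1 < ContactKM.boeckx κ μ) ∧
    (S.HasClass (S.eigenDist (√(1 - κ))) (S.eigenDist (-√(1 - κ))) .II ↔
      -1 < ContactKM.boeckx κ μ ∧ ContactKM.boeckx κ μ < 1) ∧
    (S.HasClass (S.eigenDist (√(1 - κ))) (S.eigenDist (-√(1 - κ))) .III ↔
      ContactKM.boeckx κ μ < -1) ∧
    (S.HasClass (S.eigenDist (√(1 - κ))) (S.eigenDist (-√(1 - κ))) .IV ↔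
      ContactKM.boeckx κ μ = 1) ∧
    (S.HasClass (S.eigenDist (√(1 - κ))) (S.eigenDist (-√(1 - κ))) .V ↔
      ContactKM.boeckx κ μ = -1) := by
  obtain ⟨D, hD, hR⟩ := hκμ
  have hκ : κ < 1 := S.kappa_lt_one hD hR hS
  have hpos : 0 < √(1 - κ) := Real.sqrt_pos.2 (by linarith)
  have hsq : √(1 - κ) ^ 2 = 1 - κ := Real.sq_sqrt (by linarith)
  have hsq' : (-√(1 - κ)) ^ 2 = 1 - κ := by rw [neg_sq, hsq]
  have hne' : -√(1 - κ) ≠ 0 := neg_ne_zero.2 hpos.ne'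
  have iI : S.HasClass (S.eigenDist (√(1 - κ))) (S.eigenDist (-√(1 - κ))) .I ↔
      1 < ContactKM.boeckx κ μ := by
    simp only [ContactKM.ContactMetricStructure.HasClass,
      S.positiveDefinite_iff hD hR hS hpos.ne' hsq, S.positiveDefinite_iff hD hR hS hne' hsq',
      ContactKM.boeckx, lt_div_iff₀ hpos]
    constructor
    · rintro ⟨-, h⟩; linarith
    · intro h; constructor <;> linarith
  have iII : S.HasClass (S.eigenDist (√(1 - κ))) (S.eigenDist (-√(1 - κ))) .II ↔
      -1 < ContactKM.boeckx κ μ ∧ ContactKM.boeckx κ μ < 1 := by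
    simp only [ContactKM.ContactMetricStructure.HasClass,
      S.positiveDefinite_iff hD hR hS hpos.ne' hsq, S.negativeDefinite_iff hD hR hS hne' hsq',
      ContactKM.boeckx, lt_div_iff₀ hpos, div_lt_iff₀ hpos]
    constructor <;> rintro ⟨h1, h2⟩ <;> constructor <;> linarith
  have iIII : S.HasClass (S.eigenDist (√(1 - κ))) (S.eigenDist (-√(1 - κ))) .III ↔
      ContactKM.boeckx κ μ < -1 := by
    simp only [ContactKM.ContactMetricStructure.HasClass,
      S.negativeDefinite_iff hD hR hS hpos.ne' hsq, S.negativeDefinite_iff hD hR hS hne' hsq',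
      ContactKM.boeckx, div_lt_iff₀ hpos]
    constructor
    · rintro ⟨h, -⟩; linarith
    · intro h; constructor <;> linarith
  have iIV : S.HasClass (S.eigenDist (√(1 - κ))) (S.eigenDist (-√(1 - κ))) .IV ↔
      ContactKM.boeckx κ μ = 1 := by
    simp only [ContactKM.ContactMetricStructure.HasClass,
      S.positiveDefinite_iff hD hR hS hpos.ne' hsq, S.flat_iff hD hR hS hne' hsq',
      ContactKM.boeckx, div_eq_iff hpos.ne']
    constructor
    · rintro ⟨-, h⟩; linarith
    · intro h; constructor <;> linarith
  have iV : S.HasClass (S.eigenDist (√(1 - κ))) (S.eigenDist (-√(1 - κ))) .V ↔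
      ContactKM.boeckx κ μ = -1 := by
    simp only [ContactKM.ContactMetricStructure.HasClass,
      S.flat_iff hD hR hS hpos.ne' hsq, S.negativeDefinite_iff hD hR hS hne' hsq',
      ContactKM.boeckx, div_eq_iff hpos.ne']
    constructor
    · rintro ⟨h, -⟩; linarith
    · intro h; constructor <;> linarith
  refine ⟨hκ, ⟨ContactKM.ContactMetricStructure.isLegendreFoliation_eigenDist hD hR hpos.ne' hsq,
    ContactKM.ContactMetricStructure.isLegendreFoliation_eigenDist hD hR hne' hsq',
    fun x => S.eigenDist_inf_neg hD hpos.ne'⟩, ?_, ?_, iI, iII, iIII, iIV, iV⟩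
  · rw [S.flat_iff hD hR hS hpos.ne' hsq, S.flat_iff hD hR hS hne' hsq']
    rintro ⟨h1, h2⟩
    linarith
  · refine existsUnique_of_exists_of_unique ?_ ?_
    · rcases lt_trichotomy (ContactKM.boeckx κ μ) 1 with h | h | h
      · rcases lt_trichotomy (ContactKM.boeckx κ μ) (-1) with h' | h' | h'
        · exact ⟨_, iIII.2 h'⟩
        · exact ⟨_, iV.2 h'⟩
        · exact ⟨_, iII.2 ⟨h', h⟩⟩
      · exact ⟨_, iIV.2 h⟩
      · exact ⟨_, iI.2 h⟩
    · intro c d hc hd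
      cases c <;> cases d <;> first | rfl | skip
      all_goals
        simp only [iI, iII, iIII, iIV, iV] at hc hd
        exfalso
        linarith
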